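/- Let $\Omega_1,\Omega_2\subset\mathbb{C}^n$ be bounded domains with $C^2$-smooth boundary, i.e. $\Omega_k=\{r_k<0\}$ is connected and bounded, where $r_k$ is a real-valued $C^2$ function on $\mathbb{C}^n$ with $dr_k\neq0$ on $b\Omega_k$. Let $d_k$ be the Euclidean distance to $b\Omega_k$ and let $\delta_k$ be the signed distance, $\delta_k=-d_k$ in $\Omega_k$ and $\delta_k=d_k$ in $\mathbb{C}^n\setminus\Omega_k$; it is $C^2$ near $b\Omega_k$. For $p\in\Omega_1$ near $b\Omega_1$ let $$N_{1p}=2\sqrt2\sum_{j=1}^n\frac{\partial\delta_1}{\partial\bar z_j}(p)\,\frac{\partial}{\partial z_j}$$ be the complex normal direction; $(1,0)$-vectors are identified with vectors in $\mathbb{C}^n$, and $\langle\partial\delta_2(q),X\rangle=\sum_{j}\frac{\partial\delta_2}{\partial z_j}(q)X_j$. Let $\Phi\colon\Omega_1\to\Omega_2$ be a proper holomorphic map which uniformly preserves the complex normal direction: there are a neighborhood $U$ of $b\Omega_1$ and a constant $C>0$ such that $$\|\Phi_{*p}(N_{1p})\|\le C\,\bigl|\langle\partial\delta_2(\Phi(p)),\Phi_{*p}(N_{1p})\rangle\bigr|\qquad\text{for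 all }p\in\Omega_1\cap U .$$ Suppose moreover that for some $\alpha\in(0,1]$ there is a constant $C>0$ with $$d_2(\Phi(z))\le C\,d_1(z)^{\alpha}\qquad\text{for all }z\in\Omega_1 .$$ Then $\Phi\in\operatorname{Lip}_{\alpha/2}(\Omega_1)$, i.e. $\Phi$ is bounded and there is a constant $C$ such that $\|\Phi(z)-\Phi(w)\|\le C\|z-w\|^{\alpha/2}$ for all $z,w\in\Omega_1$. -/

import Mathlib

noncomputable section

namespace NormalMapping

/-- Complex Euclidean space `ℂⁿ` with its Hermitian norm. -/
abbrev Cn (n : ℕ) : Type := EuclideanSpace ℂ (Fin n)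

/-- A bounded domain (nonempty connected open set) in `ℂⁿ` with `C²`-smooth boundary: it is
`{r < 0}` for a real-valued `C²` function `r` with `dr ≠ 0` on the boundary. -/
structure IsBoundedC2Domain {n : ℕ} (Ω : Set (Cn n)) : Prop where
  isOpen : IsOpen Ω
  isConnected : IsConnected Ω
  isBounded : Bornology.IsBounded Ω
  exists_definingFunction : ∃ r : Cn n → ℝ, ContDiff ℝ 2 r ∧ Ω = {z | r z < 0} ∧
    ∀ z ∈ frontier Ω, fderiv ℝ r z ≠ 0

/-- The Euclidean distance to the boundary of `Ω`. -/
def bdryDist {n : ℕ} (Ω : Set (Cn n)) (z : Cn n) : ℝ := Metric.infDist z (frontier Ω)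

open Classical in
/-- The signed Euclidean distance to the boundary of `Ω`, negative in `Ω`. -/
def signedDist {n : ℕ} (Ω : Set (Cn n)) (z : Cn n) : ℝ :=
  if z ∈ Ω then -bdryDist Ω z else bdryDist Ω z

/-- `∂u/∂x_j` at `p`, where `z_j = x_j + i y_j`. -/
def partialX {n : ℕ} (u : Cn n → ℝ) (p : Cn n) (j : Fin n) : ℝ :=
  fderiv ℝ u p (EuclideanSpace.single j 1)

/-- `∂u/∂y_j` at `p`, where `z_j = x_j + i y_j`. -/
def partialY {n : ℕ} (u : Cn n → ℝ) (p : Cn n) (j : Fin n) : ℝ :=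
  fderiv ℝ u p (EuclideanSpace.single j Complex.I)

/-- `∂u/∂z_j = (∂u/∂x_j - i ∂u/∂y_j) / 2` at `p`. -/
def partialZ {n : ℕ} (u : Cn n → ℝ) (p : Cn n) (j : Fin n) : ℂ :=
  ((partialX u p j : ℂ) - Complex.I * (partialY u p j : ℂ)) / 2

/-- `∂u/∂z̄_j = (∂u/∂x_j + i ∂u/∂y_j) / 2` at `p`. -/
def partialZBar {n : ℕ} (u : Cn n → ℝ) (p : Cn n) (j : Fin n) : ℂ :=
  ((partialX u p j : ℂ) + Complex.I * (partialY u p j : ℂ)) / 2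

/-- The pairing `⟨∂u(p), X⟩ = ∑ⱼ ∂u/∂z_j(p) X_j` with the `(1,0)`-vector `X = ∑ⱼ X_j ∂/∂z_j`,
identified with the vector `(X_1, …, X_n)` of `ℂⁿ`. -/
def delPairing {n : ℕ} (u : Cn n → ℝ) (p X : Cn n) : ℂ :=
  ∑ j, partialZ u p j * X j

/-- The complex normal direction `N_p = 2√2 ∑ⱼ ∂δ/∂z̄_j(p) ∂/∂z_j` of `Ω`, where `δ` is the
signed distance to the boundary, as a vector of `ℂⁿ`. It is meant for `p` near the boundary. -/
def complexNormal {n : ℕ} (Ω : Set (Cn n)) (p : Cn n) : Cn n :=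
  WithLp.toLp 2 fun j => 2 * (Real.sqrt 2 : ℂ) * partialZBar (signedDist Ω) p j

/-- `Φ` is a proper holomorphic map from `Ω₁` to `Ω₂`. -/
def IsProperHolomorphic {n : ℕ} (Φ : Cn n → Cn n) (Ω₁ Ω₂ : Set (Cn n)) : Prop :=
  DifferentiableOn ℂ Φ Ω₁ ∧ ∃ h : Set.MapsTo Φ Ω₁ Ω₂, IsProperMap (h.restrict Φ Ω₁ Ω₂)

/-- `Φ` uniformly preserves the complex normal direction: near the boundary of `Ω₁`,
`‖Φ_{*p}(N_{1p})‖ ≤ C |⟨∂δ₂(Φ(p)), Φ_{*p}(N_{1p})⟩|`. -/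
def UniformlyPreservesComplexNormal {n : ℕ} (Φ : Cn n → Cn n) (Ω₁ Ω₂ : Set (Cn n)) : Prop :=
  ∃ U : Set (Cn n), IsOpen U ∧ frontier Ω₁ ⊆ U ∧ ∃ C : ℝ, 0 < C ∧ ∀ p ∈ Ω₁ ∩ U,
    ‖fderiv ℂ Φ p (complexNormal Ω₁ p)‖ ≤
      C * ‖delPairing (signedDist Ω₂) (Φ p) (fderiv ℂ Φ p (complexNormal Ω₁ p))‖

/-- The boundary distances satisfy `d₂(Φ(z)) ≤ C d₁(z)^α` on `Ω₁` for some `C > 0`. -/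
def BoundaryDistanceProperty {n : ℕ} (Φ : Cn n → Cn n) (Ω₁ Ω₂ : Set (Cn n)) (α : ℝ) : Prop :=
  ∃ C : ℝ, 0 < C ∧ ∀ z ∈ Ω₁, bdryDist Ω₂ (Φ z) ≤ C * bdryDist Ω₁ z ^ α

/-- `f` belongs on `Ω` to the Lipschitz class of order `β`, for `0 < β < 1`: it is bounded
and Hölder continuous with exponent `β`. -/
def InLip {n : ℕ} (β : ℝ) (f : Cn n → Cn n) (Ω : Set (Cn n)) : Prop :=
  (∃ M : ℝ, ∀ z ∈ Ω, ‖f z‖ ≤ M) ∧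
    ∃ C : ℝ, ∀ z ∈ Ω, ∀ w ∈ Ω, ‖f z - f w‖ ≤ C * ‖z - w‖ ^ β

end NormalMapping

end

/-! Write `β = α / 2`. The proof bounds the derivative of `Φ` along the normal by `d₁ ^ (β - 1)`,
then shows that for a bounded holomorphic map this one transversal direction suffices.

Normal bound: at `p`, `Φ` is holomorphic on a ball of radius `d₁(p)` with values in `Ω₂`. Since `r₂
∘ Φ` stays negative there, a second-order expansion with a step balancing linear and quadratic terms
bounds the normal component of `Φ_* X` by `√d₂(Φ(p)) / d₁(p) * ‖X‖` (`exists_normal_component_le`).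
The distance hypothesis turns this into `d₁ ^ (β - 1)`, and preservation of the complex normal
extends it to all of `Φ_* N`. Only differentiability of the distance at a point is used: it holds on
a dense set, and the estimate is transferred to the continuous field `V = grad r₁`.

Hölder bound: push `z` and `w` inwards along `V` by a multiple of `η = ‖z - w‖`. Each push costs `∫
s ^ (β - 1) ds`, of order `η ^ β`. Since `∂_V Φ` is `O(d ^ (β - 1))` on balls of radius comparable
to `d`, its variation over distance `η` is `O(η d ^ (β - 2))`. Integrating from fixed depth out to
depth of order `η` bounds the difference at the pushed points by `η ^ β` too. -/

namespace NormalMapping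

open Metric Set Filter Topology

/-! ### Cauchy and Schwarz estimates for bounded holomorphic maps. -/

section Holomorphic

variable {E F : Type*} [NormedAddCommGroup E] [NormedSpace ℂ E]
  [NormedAddCommGroup F] [NormedSpace ℂ F]

theorem norm_fderiv_le_of_norm_le_ball {Φ : E → F} {a : E} {ρ M : ℝ} (hρ : 0 < ρ)
    (hd : DifferentiableOn ℂ Φ (ball a ρ)) (hM : ∀ x ∈ ball a ρ, ‖Φ x‖ ≤ M) :
    ‖fderiv ℂ Φ a‖ ≤ 2 * M / ρ := by
  refine Complex.norm_fderiv_le_div_of_mapsTo_ball hd (fun x hx => ?_) hρ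
  rw [mem_closedBall, dist_eq_norm]
  linarith [norm_sub_le (Φ x) (Φ a), hM x hx, hM a (mem_ball_self hρ)]

theorem hasDerivAt_comp_add_smul {Φ : E → F} {x e : E} {σ : ℂ}
    (h : DifferentiableAt ℂ Φ (x + σ • e)) :
    HasDerivAt (fun τ : ℂ => Φ (x + τ • e)) (fderiv ℂ Φ (x + σ • e) e) σ := by
  have h1 : HasDerivAt (fun τ : ℂ => x + τ • e) e σ := by
    simpa using ((hasDerivAt_id σ).smul_const e).const_add x
  exact h.hasFDerivAt.comp_hasDerivAt σ h1

/-- A bound for a directional derivative of a holomorphic map gives a Lipschitz bound for it. -/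
theorem norm_fderiv_apply_sub_le {Φ : E → F} {a b e : E} {ρ B : ℝ} (hρ : 0 < ρ)
    (hd : DifferentiableOn ℂ Φ (ball a ρ)) (hB : ∀ x ∈ ball a ρ, ‖fderiv ℂ Φ x e‖ ≤ B)
    (hb : b ∈ ball a (ρ / 2)) :
    ‖fderiv ℂ Φ b e - fderiv ℂ Φ a e‖ ≤ 4 * B / ρ * dist b a := by
  have hB0 : 0 ≤ B := (norm_nonneg _).trans (hB a (mem_ball_self hρ))
  have hdiff : ∀ x ∈ ball a ρ, DifferentiableAt ℂ Φ x := fun x hx =>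
    hd.differentiableAt (isOpen_ball.mem_nhds hx)
  -- Steps `σ • e` with `|σ| < r` move by less than `ρ / 2`; the `+ 1` covers `e = 0`.
  set r : ℝ := ρ / 2 / (‖e‖ + 1) with hr
  have he : 0 < ‖e‖ + 1 := by positivity
  have hr0 : 0 < r := by positivity
  have hmem : ∀ x ∈ ball a (ρ / 2), ∀ σ ∈ ball (0 : ℂ) r, x + σ • e ∈ ball a ρ := by
    intro x hx σ hσ
    rw [mem_ball, dist_eq_norm] at hx ⊢
    rw [mem_ball_zero_iff] at hσ
    have h1 : ‖σ‖ * (‖e‖ + 1) < ρ / 2 := (lt_div_iff₀ he).1 hσ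
    have h2 : ‖σ • e‖ ≤ ‖σ‖ * (‖e‖ + 1) := by
      rw [norm_smul]; nlinarith [norm_nonneg σ]
    calc ‖x + σ • e - a‖ = ‖(x - a) + σ • e‖ := by congr 1; abel
      _ ≤ ‖x - a‖ + ‖σ • e‖ := norm_add_le _ _
      _ < ρ := by linarith
  have hH : ∀ x ∈ ball a (ρ / 2), ∀ σ ∈ ball (0 : ℂ) r, ‖Φ (x + σ • e) - Φ x‖ ≤ B * ‖σ‖ := by
    intro x hx σ hσ
    have := (convex_ball (0 : ℂ) r).norm_image_sub_le_of_norm_hasDerivWithin_le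
      (f := fun τ : ℂ => Φ (x + τ • e)) (f' := fun τ => fderiv ℂ Φ (x + τ • e) e) (C := B)
      (fun τ hτ => (hasDerivAt_comp_add_smul (hdiff _ (hmem x hx τ hτ))).hasDerivWithinAt)
      (fun τ hτ => hB _ (hmem x hx τ hτ)) (mem_ball_self hr0) hσ
    simpa using this
  have ha : a ∈ ball a (ρ / 2) := mem_ball_self (by positivity)
  -- The quantity to bound is a derivative at `σ = 0`. The Schwarz lemma in `x` for `Φ (x + σ • e) -
  -- Φ x`, which is at most `B * ‖σ‖` on the half ball, gives the needed Lipschitz bound in `σ`,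
  -- without using holomorphy of `fderiv ℂ Φ`.
  have hg : HasDerivAt (fun τ : ℂ => Φ (b + τ • e) - Φ (a + τ • e))
      (fderiv ℂ Φ b e - fderiv ℂ Φ a e) 0 := by
    have h0 := mem_ball_self (x := (0 : ℂ)) hr0
    have h1 := hasDerivAt_comp_add_smul (hdiff _ (hmem b hb 0 h0))
    have h2 := hasDerivAt_comp_add_smul (hdiff _ (hmem a ha 0 h0))
    have h3 := h1.sub h2
    simp only [zero_smul, add_zero] at h3
    exact h3
  refine hg.le_of_lip' (by positivity) ?_
  filter_upwards [ball_mem_nhds (0 : ℂ) hr0] with σ hσ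
  have hS := Complex.dist_le_div_mul_dist_of_mapsTo_ball
    (f := fun x => Φ (x + σ • e) - Φ x) (c := a) (R₁ := ρ / 2) (R₂ := 2 * (B * ‖σ‖)) (z := b)
    (fun x hx => ?_) (fun x hx => ?_) hb
  · rw [dist_eq_norm] at hS
    have e1 : Φ (b + σ • e) - Φ (a + σ • e) - (Φ (b + (0 : ℂ) • e) - Φ (a + (0 : ℂ) • e))
        = Φ (b + σ • e) - Φ b - (Φ (a + σ • e) - Φ a) := by simp only [zero_smul, add_zero]; abel
    rw [e1, sub_zero]
    refine hS.trans (le_of_eq ?_)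
    field_simp
    ring
  · have h1 : DifferentiableAt ℂ (fun x => Φ (x + σ • e)) x :=
      (hdiff _ (hmem x hx σ hσ)).comp x (differentiableAt_id.add_const _)
    exact (h1.sub (hdiff x (ball_subset_ball (by linarith) hx))).differentiableWithinAt
  · rw [mem_closedBall, dist_eq_norm]
    linarith [norm_sub_le (Φ (x + σ • e) - Φ x) (Φ (a + σ • e) - Φ a), hH x hx σ hσ,
      hH a ha σ hσ]

/-- On the half ball Cauchy's estimate gives `B = 4 * M / ρ * ‖e‖` in every direction; the
directional estimate at radius `ρ / 2` then yields the factor 32. -/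
theorem norm_fderiv_sub_fderiv_le {Φ : E → F} {a x : E} {ρ M : ℝ} (hρ : 0 < ρ)
    (hd : DifferentiableOn ℂ Φ (ball a ρ)) (hM : ∀ x ∈ ball a ρ, ‖Φ x‖ ≤ M)
    (hx : dist x a < ρ / 4) :
    ‖fderiv ℂ Φ x - fderiv ℂ Φ a‖ ≤ 32 * M / ρ ^ 2 * dist x a := by
  have hM0 : 0 ≤ M := (norm_nonneg _).trans (hM a (mem_ball_self hρ))
  have hB : ∀ e, ∀ x ∈ ball a (ρ / 2), ‖fderiv ℂ Φ x e‖ ≤ 2 * M / (ρ / 2) * ‖e‖ := by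
    intro e x hx
    have hs : ball x (ρ / 2) ⊆ ball a ρ := ball_subset_ball' (by
      rw [mem_ball] at hx; linarith)
    exact ((fderiv ℂ Φ x).le_opNorm e).trans (mul_le_mul_of_nonneg_right
      (norm_fderiv_le_of_norm_le_ball (by positivity) (hd.mono hs) fun y hy => hM y (hs hy))
      (norm_nonneg e))
  refine ContinuousLinearMap.opNorm_le_bound _ (by positivity) fun e => ?_
  have h1 := norm_fderiv_apply_sub_le (b := x) (by positivity)
    (hd.mono (ball_subset_ball (by linarith))) (hB e) (by rw [mem_ball]; linarith)
  refine h1.trans (le_of_eq ?_)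
  field_simp
  ring

theorem continuousAt_fderiv {Φ : E → F} {Ω : Set E} (hΩ : IsOpen Ω)
    (hd : DifferentiableOn ℂ Φ Ω) {M : ℝ} (hM : ∀ x ∈ Ω, ‖Φ x‖ ≤ M) {a : E} (ha : a ∈ Ω) :
    ContinuousAt (fderiv ℂ Φ) a := by
  obtain ⟨ρ, hρ, hsub⟩ := Metric.isOpen_iff.1 hΩ a ha
  rw [ContinuousAt, tendsto_iff_norm_sub_tendsto_zero]
  refine squeeze_zero' (Eventually.of_forall fun x => norm_nonneg _)
    (by filter_upwards [ball_mem_nhds a (show 0 < ρ / 4 by positivity)] with x hx using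
      norm_fderiv_sub_fderiv_le hρ (hd.mono hsub) (fun y hy => hM y (hsub hy)) hx) ?_
  have : Tendsto (fun x => dist x a) (𝓝 a) (𝓝 0) := by
    simpa using (continuous_id.dist continuous_const).tendsto (x := a) (f := fun x => dist x a)
  simpa using this.const_mul (32 * M / ρ ^ 2)

/-- The first-order Taylor estimate for a bounded holomorphic map on a ball. -/
theorem norm_sub_sub_fderiv_le {Φ : E → F} {a v : E} {ρ M : ℝ} (hρ : 0 < ρ)
    (hd : DifferentiableOn ℂ Φ (ball a ρ)) (hM : ∀ x ∈ ball a ρ, ‖Φ x‖ ≤ M)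
    (hv : ‖v‖ < ρ / 4) :
    ‖Φ (a + v) - Φ a - fderiv ℂ Φ a v‖ ≤ 32 * M / ρ ^ 2 * ‖v‖ ^ 2 := by
  have hM0 : 0 ≤ M := (norm_nonneg _).trans (hM a (mem_ball_self hρ))
  have hL : ∀ x ∈ closedBall a ‖v‖, ‖fderiv ℂ Φ x - fderiv ℂ Φ a‖ ≤ 32 * M / ρ ^ 2 * ‖v‖ := by
    intro x hx
    rw [mem_closedBall] at hx
    exact (norm_fderiv_sub_fderiv_le hρ hd hM (hx.trans_lt hv)).trans (by gcongr)
  have h := (convex_closedBall a ‖v‖).norm_image_sub_le_of_norm_fderiv_le' (𝕜 := ℂ) (f := Φ)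
    (fun x hx => hd.differentiableAt (isOpen_ball.mem_nhds (mem_ball.2
      ((mem_closedBall.1 hx).trans_lt (by linarith))))) hL (mem_closedBall_self (norm_nonneg v))
    (y := a + v) (by simp)
  rw [add_sub_cancel_left] at h
  exact h.trans (le_of_eq (by ring))

end Holomorphic

/-! ### Quantitative defining functions and the boundary distance. -/

/-- `r` is a `C²` defining function of the bounded set `Ω`, with a radius `R` of a ball containing
`Ω`, a bound `L` and a Lipschitz constant `K` for `dr` near that ball, and a lower bound `m` for
`dr` on the boundary. -/
structure IsDefiningFunction {n : ℕ} (Ω : Set (Cn n)) (r : Cn n → ℝ) (R L K m : ℝ) : Prop where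
  isOpen : IsOpen Ω
  R_pos : 0 < R
  L_pos : 0 < L
  K_pos : 0 < K
  m_pos : 0 < m
  contDiff : ContDiff ℝ 2 r
  mem_iff : ∀ z, z ∈ Ω ↔ r z < 0
  subset_ball : Ω ⊆ ball 0 R
  norm_fderiv_le : ∀ z ∈ closedBall (0 : Cn n) (R + 1), ‖fderiv ℝ r z‖ ≤ L
  norm_fderiv_sub_le : ∀ z ∈ closedBall (0 : Cn n) (R + 1), ∀ w ∈ closedBall (0 : Cn n) (R + 1),
    ‖fderiv ℝ r z - fderiv ℝ r w‖ ≤ K * ‖z - w‖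
  le_norm_fderiv : ∀ z ∈ frontier Ω, m ≤ ‖fderiv ℝ r z‖

theorem IsBoundedC2Domain.exists_isDefiningFunction {n : ℕ} {Ω : Set (Cn n)}
    (h : IsBoundedC2Domain Ω) : ∃ r R L K m, IsDefiningFunction Ω r R L K m := by
  obtain ⟨r, hr, hΩ, hd⟩ := h.exists_definingFunction
  obtain ⟨R, hR⟩ := h.isBounded.subset_ball_lt 0 0
  have hr1 : ContDiff ℝ 1 (fderiv ℝ r) := hr.fderiv_right (by norm_num)
  have hc1 : Continuous (fderiv ℝ r) := hr1.continuous
  have hc2 : Continuous (fderiv ℝ (fderiv ℝ r)) := hr1.continuous_fderiv (by norm_num)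
  have hB := isCompact_closedBall (0 : Cn n) (R + 1)
  obtain ⟨L, hL⟩ := hB.exists_bound_of_continuousOn hc1.continuousOn
  obtain ⟨K, hK⟩ := hB.exists_bound_of_continuousOn (E := Cn n →L[ℝ] Cn n →L[ℝ] ℝ) hc2.continuousOn
  have hF : IsCompact (frontier Ω) :=
    Metric.isCompact_of_isClosed_isBounded isClosed_frontier
      (h.isBounded.closure.subset frontier_subset_closure)
  have hm : ∃ m, 0 < m ∧ ∀ z ∈ frontier Ω, m ≤ ‖fderiv ℝ r z‖ := by
    rcases (frontier Ω).eq_empty_or_nonempty with h0 | h0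
    · exact ⟨1, one_pos, by simp [h0]⟩
    · obtain ⟨z, hz, hmin⟩ := hF.exists_isMinOn h0 hc1.norm.continuousOn
      exact ⟨_, norm_pos_iff.2 (hd z hz), hmin⟩
  obtain ⟨m, hm0, hm⟩ := hm
  refine ⟨r, R, max L 1, max K 1, m, h.isOpen, hR.1, by positivity, by positivity, hm0, hr,
    fun z => by rw [hΩ]; rfl, hR.2, fun z hz => (hL z hz).trans (le_max_left _ _), ?_, hm⟩
  intro z hz w hw
  exact (convex_closedBall (0 : Cn n) (R + 1)).norm_image_sub_le_of_norm_fderiv_le (𝕜 := ℝ)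
    (fun x _ => (hr1.differentiable (by norm_num)) x)
    (fun x hx => (hK x hx).trans (le_max_left _ _)) hw hz

theorem bdryDist_le_add {n : ℕ} (Ω : Set (Cn n)) (x y : Cn n) :
    bdryDist Ω x ≤ bdryDist Ω y + ‖x - y‖ := by
  rw [← dist_eq_norm]; exact infDist_le_infDist_add_dist

namespace IsDefiningFunction

variable {n : ℕ} {Ω : Set (Cn n)} {r : Cn n → ℝ} {R L K m : ℝ}

theorem closure_subset (h : IsDefiningFunction Ω r R L K m) : closure Ω ⊆ closedBall 0 R :=
  closure_minimal (h.subset_ball.trans ball_subset_closedBall) isClosed_closedBall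

theorem isCompact_frontier (h : IsDefiningFunction Ω r R L K m) : IsCompact (frontier Ω) :=
  (isCompact_closedBall (0 : Cn n) R).of_isClosed_subset isClosed_frontier
    (frontier_subset_closure.trans h.closure_subset)

theorem differentiable (h : IsDefiningFunction Ω r R L K m) : Differentiable ℝ r :=
  h.contDiff.differentiable (by norm_num)

theorem nonpos_of_mem_closure (h : IsDefiningFunction Ω r R L K m) {z : Cn n}
    (hz : z ∈ closure Ω) : r z ≤ 0 :=
  closure_minimal (t := {z | r z ≤ 0}) (fun x hx => ((h.mem_iff x).1 hx).le)
    (isClosed_le h.contDiff.continuous continuous_const) hz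

theorem eq_zero_of_mem_frontier (h : IsDefiningFunction Ω r R L K m) {z : Cn n}
    (hz : z ∈ frontier Ω) : r z = 0 := by
  refine le_antisymm (h.nonpos_of_mem_closure hz.1) (not_lt.1 fun hlt => ?_)
  rw [h.isOpen.frontier_eq] at hz
  exact hz.2 ((h.mem_iff z).2 hlt)

theorem frontier_nonempty [Nontrivial (Cn n)] (h : IsDefiningFunction Ω r R L K m)
    (hne : Ω.Nonempty) : (frontier Ω).Nonempty := by
  by_contra hc
  rw [not_nonempty_iff_eq_empty, ← isClopen_iff_frontier_eq_empty] at hc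
  have hu := (isClopen_iff.1 hc).resolve_left hne.ne_empty
  have := NormedSpace.unbounded_univ ℝ (Cn n)
  exact this (hu ▸ isBounded_ball.subset h.subset_ball)

theorem exists_nearest (h : IsDefiningFunction Ω r R L K m) (hF : (frontier Ω).Nonempty)
    (x : Cn n) : ∃ y ∈ frontier Ω, ‖x - y‖ = bdryDist Ω x := by
  obtain ⟨y, hy, he⟩ := h.isCompact_frontier.exists_infDist_eq_dist hF x
  exact ⟨y, hy, by rw [← dist_eq_norm]; exact he.symm⟩

theorem bdryDist_pos (h : IsDefiningFunction Ω r R L K m) (hF : (frontier Ω).Nonempty)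
    {x : Cn n} (hx : x ∈ Ω) : 0 < bdryDist Ω x := by
  rw [bdryDist, ← infDist_pos_iff_notMem_closure hF, isClosed_frontier.closure_eq,
    h.isOpen.frontier_eq]
  exact fun hc => hc.2 hx

/-- The ball is connected and misses the frontier, so it cannot leave `Ω`. -/
theorem ball_subset (h : IsDefiningFunction Ω r R L K m) (hF : (frontier Ω).Nonempty)
    {x : Cn n} (hx : x ∈ Ω) : ball x (bdryDist Ω x) ⊆ Ω := by
  refine (convex_ball x _).isPreconnected.subset_of_closure_inter_subset h.isOpen
    ⟨x, mem_ball_self (h.bdryDist_pos hF hx), hx⟩ fun y hy => ?_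
  by_contra hyn
  have hyf : y ∈ frontier Ω := by rw [h.isOpen.frontier_eq]; exact ⟨hy.1, hyn⟩
  have h1 : bdryDist Ω x ≤ dist x y := infDist_le_dist_of_mem hyf
  have h2 := hy.2
  rw [mem_ball, dist_comm] at h2
  linarith

theorem neg_le_mul_bdryDist (h : IsDefiningFunction Ω r R L K m) (hF : (frontier Ω).Nonempty)
    {x : Cn n} (hx : x ∈ Ω) : -r x ≤ L * bdryDist Ω x := by
  obtain ⟨y, hy, he⟩ := h.exists_nearest hF x
  have hs : closedBall (0 : Cn n) R ⊆ closedBall 0 (R + 1) := closedBall_subset_closedBall (by simp)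
  have := (convex_closedBall (0 : Cn n) (R + 1)).norm_image_sub_le_of_norm_fderiv_le (𝕜 := ℝ)
    (f := r) (fun z _ => h.differentiable z) h.norm_fderiv_le
    (hs (h.closure_subset (frontier_subset_closure hy)))
    (hs (h.closure_subset (subset_closure hx)))
  rw [h.eq_zero_of_mem_frontier hy, sub_zero, he, Real.norm_eq_abs] at this
  exact (neg_le_abs _).trans this

theorem bdryDist_le (h : IsDefiningFunction Ω r R L K m) (hF : (frontier Ω).Nonempty)
    {x : Cn n} (hx : x ∈ Ω) : bdryDist Ω x ≤ 2 * R := by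
  obtain ⟨y, hy⟩ := hF
  have h1 : bdryDist Ω x ≤ dist x y := infDist_le_dist_of_mem hy
  have h2 := h.closure_subset (frontier_subset_closure hy)
  have h3 := h.closure_subset (subset_closure hx)
  rw [mem_closedBall] at h2 h3
  linarith [dist_triangle_right x y 0]

/-- Second-order Taylor estimate. -/
theorem abs_taylor_le (h : IsDefiningFunction Ω r R L K m) {x y : Cn n}
    (hx : x ∈ closedBall (0 : Cn n) (R + 1)) (hy : y ∈ closedBall (0 : Cn n) (R + 1)) :
    |r y - r x - fderiv ℝ r x (y - x)| ≤ K * ‖y - x‖ ^ 2 := by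
  have hseg : segment ℝ x y ⊆ closedBall (0 : Cn n) (R + 1) :=
    (convex_closedBall _ _).segment_subset hx hy
  have h1 := (convex_segment x y).norm_image_sub_le_of_norm_fderiv_le' (𝕜 := ℝ) (f := r)
    (φ := fderiv ℝ r x) (C := K * ‖y - x‖) (fun z _ => h.differentiable z)
    (fun z hz => (h.norm_fderiv_sub_le z (hseg hz) x hx).trans
      (mul_le_mul_of_nonneg_left (by
        simpa [dist_eq_norm] using norm_sub_le_of_mem_segment hz) h.K_pos.le))
    (left_mem_segment ℝ x y) (right_mem_segment ℝ x y)
  rw [Real.norm_eq_abs] at h1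
  linarith

/-- Where the boundary distance is differentiable, its differential is a unit covector
proportional to `dr` at any nearest boundary point. -/
theorem exists_fderiv_eq_smul [Nontrivial (Cn n)] (h : IsDefiningFunction Ω r R L K m)
    (hF : (frontier Ω).Nonempty)
    {q y : Cn n} (hq : q ∈ Ω) (hy : y ∈ frontier Ω) (hqy : ‖q - y‖ = bdryDist Ω q)
    (hd : DifferentiableAt ℝ (bdryDist Ω) q) :
    ∃ μ : ℝ, fderiv ℝ r y = μ • fderiv ℝ (bdryDist Ω) q ∧ |μ| = ‖fderiv ℝ r y‖ ∧
      ‖fderiv ℝ (bdryDist Ω) q‖ = 1 := by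
  have hpos := h.bdryDist_pos hF hq
  have hne : q - y ≠ 0 := norm_pos_iff.1 (by rw [hqy]; exact hpos)
  have hcd : ContDiffAt ℝ 1 (norm : Cn n → ℝ) (q - y) := contDiffAt_norm ℂ hne
  have hcd' : ContDiffAt ℝ 1 (norm : Cn n → ℝ) (y - q) :=
    contDiffAt_norm ℂ (by rw [← neg_sub]; exact neg_ne_zero.2 hne)
  have hnd := hcd.differentiableAt (by norm_num)
  set N := fderiv ℝ (norm : Cn n → ℝ) (q - y) with hN
  have hN1 : ‖N‖ = 1 := norm_fderiv_norm hnd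
  have hsub : HasFDerivAt (fun x : Cn n => ‖x - y‖) N q := by
    have := HasFDerivAt.comp (f := fun x : Cn n => x - y) q hnd.hasFDerivAt
      ((hasFDerivAt_id q).sub_const y)
    exact this
  have hD : fderiv ℝ (bdryDist Ω) q = N := by
    -- The distance to `y` dominates the boundary distance, with equality at `q`, so the two
    -- differentials agree.
    have hmin : IsLocalMin (fun x => ‖x - y‖ - bdryDist Ω x) q := by
      refine Eventually.of_forall fun x => ?_
      have : bdryDist Ω x ≤ dist x y := infDist_le_dist_of_mem hy
      rw [dist_eq_norm] at this
      simp only [hqy, sub_self, sub_nonneg]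
      exact this
    have h0 := hmin.hasFDerivAt_eq_zero (hsub.sub hd.hasFDerivAt)
    exact (sub_eq_zero.1 h0).symm
  have hN' : fderiv ℝ (norm : Cn n → ℝ) (y - q) = -N := by
    have := fderiv_norm_smul_neg (x := q - y) (t := (-1 : ℝ)) (by norm_num)
    simpa using this
  have hs : HasStrictFDerivAt (fun x : Cn n => ‖x - q‖) (-N) y := by
    have h1 := hcd'.hasStrictFDerivAt (by norm_num)
    rw [hN'] at h1
    have := HasStrictFDerivAt.comp (f := fun x : Cn n => x - q) y h1
      ((hasStrictFDerivAt_id y).sub_const q)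
    simpa using this
  have hr : HasStrictFDerivAt r (fderiv ℝ r y) y :=
    h.contDiff.contDiffAt.hasStrictFDerivAt (by norm_num)
  -- The sphere about `q` through `y` lies in the closure of `Ω`, where `r ≤ 0 = r y`. Lagrange
  -- multipliers then make `dr` at `y` collinear with the differential of the norm.
  have hext : IsLocalExtrOn r {x | ‖x - q‖ = ‖y - q‖} y := by
    refine Or.inr (eventually_nhdsWithin_of_forall fun x hx => ?_)
    rw [h.eq_zero_of_mem_frontier hy]
    apply h.nonpos_of_mem_closure
    refine closure_mono (h.ball_subset hF hq) ?_
    rw [closure_ball _ hpos.ne', mem_closedBall, dist_eq_norm, hx, norm_sub_rev, hqy]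
  obtain ⟨a, b, hab, hlin⟩ := hext.exists_multipliers_of_hasStrictFDerivAt_1d hs hr
  have hNne : N ≠ 0 := norm_pos_iff.1 (by rw [hN1]; exact one_pos)
  have hb : b ≠ 0 := by
    rintro rfl
    rw [zero_smul, add_zero, smul_neg, neg_eq_zero, smul_eq_zero] at hlin
    exact hab (by rw [hlin.resolve_right hNne]; rfl)
  have hmu : fderiv ℝ r y = (a / b) • N := by
    have : b • fderiv ℝ r y = a • N := by
      rw [smul_neg, neg_add_eq_zero] at hlin; exact hlin.symm
    rw [div_eq_inv_mul, mul_smul, ← this, smul_smul, inv_mul_cancel₀ hb, one_smul]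
  refine ⟨a / b, by rw [hD, hmu], ?_, by rw [hD, hN1]⟩
  rw [hmu, norm_smul, hN1, mul_one, Real.norm_eq_abs]

end IsDefiningFunction

/-! ### Real covectors as complex gradients. -/

/-- The gradient of a real covector, as a vector of `ℂⁿ`. -/
noncomputable def complexGradient {n : ℕ} (l : Cn n →L[ℝ] ℝ) : Cn n :=
  WithLp.toLp 2 fun j => (l (EuclideanSpace.single j 1) : ℂ) +
    Complex.I * (l (EuclideanSpace.single j Complex.I) : ℂ)

section complexGradient

variable {n : ℕ}

theorem complexGradient_smul (μ : ℝ) (l : Cn n →L[ℝ] ℝ) :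
    complexGradient (μ • l) = (μ : ℂ) • complexGradient l := by
  ext j
  simp [complexGradient]
  ring

theorem complexGradient_sub (l l' : Cn n →L[ℝ] ℝ) :
    complexGradient (l - l') = complexGradient l - complexGradient l' := by
  ext j
  simp [complexGradient]
  ring

theorem re_inner_complexGradient (l : Cn n →L[ℝ] ℝ) (x : Cn n) :
    (inner ℂ (complexGradient l) x).re = l x := by
  have hx : x = ∑ j, ((x j).re • EuclideanSpace.single j (1 : ℂ) +
      (x j).im • EuclideanSpace.single j Complex.I) := by
    ext k
    simp only [WithLp.ofLp_sum, WithLp.ofLp_add, WithLp.ofLp_smul, PiLp.ofLp_single,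
      Finset.sum_apply, Pi.add_apply, Pi.smul_apply, Pi.single_apply]
    simp [Finset.sum_add_distrib]
  conv_rhs => rw [hx]
  rw [map_sum, PiLp.inner_apply, Complex.re_sum]
  refine Finset.sum_congr rfl fun j _ => ?_
  simp [complexGradient]

theorem norm_complexGradient (l : Cn n →L[ℝ] ℝ) : ‖complexGradient l‖ = ‖l‖ := by
  apply le_antisymm
  · have h1 := re_inner_complexGradient l (complexGradient l)
    have h2 : (inner ℂ (complexGradient l) (complexGradient l)).re = ‖complexGradient l‖ ^ 2 := by
      rw [inner_self_eq_norm_sq_to_K]; norm_cast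
    have h3 := (le_abs_self _).trans (l.le_opNorm (complexGradient l))
    rw [← h1, h2] at h3
    rcases (norm_nonneg (complexGradient l)).eq_or_lt with h | h
    · rw [← h]; positivity
    · nlinarith
  · refine l.opNorm_le_bound (norm_nonneg _) fun x => ?_
    rw [← re_inner_complexGradient]
    exact (Complex.abs_re_le_norm _).trans (norm_inner_le_norm _ _)

theorem complexNormal_eq (Ω : Set (Cn n)) (p : Cn n) :
    complexNormal Ω p = (Real.sqrt 2 : ℂ) • complexGradient (fderiv ℝ (signedDist Ω) p) := by
  ext j
  simp [complexNormal, complexGradient, partialZBar, partialX, partialY]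
  ring

theorem two_mul_delPairing (u : Cn n → ℝ) (p X : Cn n) :
    2 * delPairing u p X = inner ℂ (complexGradient (fderiv ℝ u p)) X := by
  rw [delPairing, Finset.mul_sum, PiLp.inner_apply]
  refine Finset.sum_congr rfl fun j _ => ?_
  simp [complexGradient, partialZ, partialX, partialY]
  ring

/-- Rotating `X` by a unimodular factor makes the pairing real and nonnegative; twice it is then a
value of the real differential. The factor 2 is discarded. -/
theorem norm_delPairing_le {u : Cn n → ℝ} {p X : Cn n} {B : ℝ}
    (hB : ∀ c : ℂ, ‖c‖ = 1 → |fderiv ℝ u p (c • X)| ≤ B) : ‖delPairing u p X‖ ≤ B := by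
  obtain ⟨c, hc, hcz⟩ : ∃ c : ℂ, ‖c‖ = 1 ∧ c * (2 * delPairing u p X) =
      (‖2 * delPairing u p X‖ : ℂ) := by
    rcases eq_or_ne (2 * delPairing u p X) 0 with h0 | h0
    · exact ⟨1, by simp, by simp [h0]⟩
    · have hn : (‖2 * delPairing u p X‖ : ℂ) ≠ 0 := by simpa using h0
      refine ⟨‖2 * delPairing u p X‖ / (2 * delPairing u p X), ?_, div_mul_cancel₀ _ h0⟩
      rw [norm_div, Complex.norm_real, norm_norm, div_self (norm_ne_zero_iff.2 h0)]
  have h := hB c hc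
  rw [← re_inner_complexGradient, inner_smul_right, ← two_mul_delPairing, hcz,
    Complex.ofReal_re, abs_norm, norm_mul] at h
  norm_num at h
  linarith [norm_nonneg (delPairing u p X)]

end complexGradient

theorem fderiv_signedDist {n : ℕ} {Ω : Set (Cn n)} (hΩ : IsOpen Ω) {p : Cn n} (hp : p ∈ Ω) :
    fderiv ℝ (signedDist Ω) p = -fderiv ℝ (bdryDist Ω) p := by
  have : signedDist Ω =ᶠ[𝓝 p] fun x => -bdryDist Ω x := by
    filter_upwards [hΩ.mem_nhds hp] with x hx
    simp [signedDist, hx]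
  rw [this.fderiv_eq, fderiv_fun_neg]

/-- Rademacher's theorem for the 1-Lipschitz distance. It replaces regularity of the distance near
the boundary. -/
theorem dense_differentiableAt_bdryDist {n : ℕ} (Ω : Set (Cn n)) :
    Dense {x | DifferentiableAt ℝ (bdryDist Ω) x} :=
  MeasureTheory.Measure.dense_of_ae (μ := MeasureTheory.Measure.addHaar)
    (lipschitz_infDist_pt (frontier Ω)).ae_differentiableAt

/-! ### The Landau-type inequality in the target. -/

/-- A Landau-type inequality: the normal component of the differential of a holomorphic map into
`Ω` is controlled by the square root of the boundary distance. -/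
theorem IsDefiningFunction.exists_normal_component_le {n : ℕ} [Nontrivial (Cn n)] {Ω : Set (Cn n)}
    {r : Cn n → ℝ} {R L K m : ℝ} (h : IsDefiningFunction Ω r R L K m)
    (hF : (frontier Ω).Nonempty) :
    ∃ A : ℝ, 0 < A ∧ ∀ (Φ : Cn n → Cn n) (p X : Cn n) (ρ : ℝ), 0 < ρ →
      DifferentiableOn ℂ Φ (ball p ρ) → MapsTo Φ (ball p ρ) Ω →
      |fderiv ℝ (bdryDist Ω) (Φ p) (fderiv ℂ Φ p X)| ≤
        A * √(bdryDist Ω (Φ p)) / ρ * ‖X‖ := by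
  have hR := h.R_pos
  have hK := h.K_pos
  have hL := h.L_pos
  have hm := h.m_pos
  -- `S` forces `τ = √d / S ≤ 1 / 8`, because `d ≤ 2 * R ≤ (R + 1) ^ 2`. `E * τ` will bound the
  -- distance from `Φ (p + v)` to the nearest point `y`, and `E₂ * τ ^ 2` collects all second-order
  -- errors.
  set S : ℝ := 8 * (R + 1) with hS
  set E : ℝ := S ^ 2 + 6 * R with hE
  set E₂ : ℝ := K * E ^ 2 + L * S ^ 2 + L * (32 * R) with hE₂
  refine ⟨E₂ / (S * m), by positivity, fun Φ p X ρ hρ hd hmap => ?_⟩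
  by_cases hdiff : DifferentiableAt ℝ (bdryDist Ω) (Φ p)
  swap
  -- Here `fderiv` takes its default value 0.
  · rw [fderiv_zero_of_not_differentiableAt hdiff]
    simp only [zero_apply, abs_zero]
    positivity
  have hp : Φ p ∈ Ω := hmap (mem_ball_self hρ)
  have hM : ∀ x ∈ ball p ρ, ‖Φ x‖ ≤ R := fun x hx => by
    have := h.subset_ball (hmap hx); rw [mem_ball_zero_iff] at this; exact this.le
  obtain ⟨y, hy, hqy⟩ := h.exists_nearest hF (Φ p)
  obtain ⟨μ, hμ, hμn, -⟩ := h.exists_fderiv_eq_smul hF hp hy hqy hdiff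
  have hdpos := h.bdryDist_pos hF hp
  have hdle := h.bdryDist_le hF hp
  set d := bdryDist Ω (Φ p) with hd_def
  set τ : ℝ := √d / S with hτ
  have hS0 : 0 < S := by positivity
  have hτ0 : 0 < τ := by positivity
  have hdτ : d = S ^ 2 * τ ^ 2 := by
    rw [hτ, div_pow, Real.sq_sqrt hdpos.le]; field_simp
  have hτ8 : τ ≤ 1 / 8 := by
    rw [hτ, div_le_iff₀ hS0, hS]
    refine (Real.sqrt_le_left (by positivity)).2 ?_
    nlinarith
  have hfr : closedBall (0 : Cn n) R ⊆ closedBall 0 (R + 1) := closedBall_subset_closedBall (by simp)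
  have hyB : y ∈ closedBall (0 : Cn n) (R + 1) :=
    hfr (h.closure_subset (frontier_subset_closure hy))
  -- Expand `r (Φ (p + v)) < 0` about `y`, where `r` vanishes. With `‖v‖ = ρ * τ` both the offset `d
  -- = S ^ 2 * τ ^ 2` and the Taylor remainders are of order `τ ^ 2`. Using `v` and `-v` later gives
  -- the absolute value.
  have key : ∀ v : Cn n, ‖v‖ = ρ * τ → fderiv ℝ r y (fderiv ℂ Φ p v) ≤ E₂ * τ ^ 2 := by
    intro v hv
    have hvρ : ‖v‖ < ρ / 4 := by rw [hv]; nlinarith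
    have hx : Φ (p + v) ∈ Ω := hmap (by rw [mem_ball, dist_eq_norm, add_sub_cancel_left]; linarith)
    have hT := norm_sub_sub_fderiv_le hρ hd hM hvρ
    set W := Φ (p + v) - Φ p - fderiv ℂ Φ p v with hW
    have hWn : ‖W‖ ≤ 32 * R * τ ^ 2 := hT.trans (le_of_eq (by rw [hv]; field_simp))
    have hDv : ‖fderiv ℂ Φ p v‖ ≤ 2 * R * τ := by
      refine ((fderiv ℂ Φ p).le_opNorm v).trans ?_
      refine (mul_le_mul_of_nonneg_right (norm_fderiv_le_of_norm_le_ball hρ hd hM)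
        (norm_nonneg v)).trans (le_of_eq ?_)
      rw [hv]; field_simp
    have hsum : Φ (p + v) - y = (Φ p - y) + fderiv ℂ Φ p v + W := by rw [hW]; abel
    have hτsq : τ ^ 2 ≤ τ / 8 := by nlinarith
    have hxy : ‖Φ (p + v) - y‖ ≤ E * τ := by
      calc ‖Φ (p + v) - y‖ ≤ ‖Φ p - y‖ + ‖fderiv ℂ Φ p v‖ + ‖W‖ := by
            rw [hsum]; exact norm_add₃_le
        _ ≤ S ^ 2 * τ ^ 2 + 2 * R * τ + 32 * R * τ ^ 2 := by
            rw [hqy, hdτ]; gcongr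
        _ ≤ S ^ 2 * τ + 2 * R * τ + 4 * R * τ := by
            have h1 : S ^ 2 * τ ^ 2 ≤ S ^ 2 * τ := by gcongr; linarith
            have h2 : R * τ ^ 2 ≤ R * (τ / 8) := by gcongr
            linarith
        _ = E * τ := by rw [hE]; ring
    have hTay := (abs_le.1 (h.abs_taylor_le hyB (hfr (h.closure_subset (subset_closure hx))))).1
    have hrx := (h.mem_iff _).1 hx
    rw [h.eq_zero_of_mem_frontier hy, sub_zero] at hTay
    have hsq : ‖Φ (p + v) - y‖ ^ 2 ≤ (E * τ) ^ 2 := by gcongr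
    have hsqK := mul_le_mul_of_nonneg_left hsq hK.le
    have hlin : fderiv ℝ r y (Φ (p + v) - y) = fderiv ℝ r y (Φ p - y) +
        fderiv ℝ r y (fderiv ℂ Φ p v) + fderiv ℝ r y W := by
      rw [hsum, map_add, map_add]
    have hop : ∀ w, -(L * ‖w‖) ≤ fderiv ℝ r y w := fun w =>
      (abs_le.1 (((fderiv ℝ r y).le_opNorm w).trans
        (mul_le_mul_of_nonneg_right (h.norm_fderiv_le y hyB) (norm_nonneg w)))).1
    have h1 := hop (Φ p - y)
    have h2 := hop W
    rw [hqy, hdτ] at h1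
    have h3 := mul_le_mul_of_nonneg_left hWn hL.le
    have : E₂ * τ ^ 2 = K * (E * τ) ^ 2 + L * (S ^ 2 * τ ^ 2) + L * (32 * R * τ ^ 2) := by
      rw [hE₂]; ring
    linarith
  rcases eq_or_ne X 0 with rfl | hX
  · simp
  have hXn : 0 < ‖X‖ := norm_pos_iff.2 hX
  set t : ℝ := ρ * τ / ‖X‖ with ht
  have ht0 : 0 < t := by positivity
  have hv : ‖(t : ℂ) • X‖ = ρ * τ := by
    rw [norm_smul, Complex.norm_real, Real.norm_of_nonneg ht0.le, ht]; field_simp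
  have hsm : fderiv ℝ r y (fderiv ℂ Φ p ((t : ℂ) • X)) = t * fderiv ℝ r y (fderiv ℂ Φ p X) := by
    rw [map_smul, Complex.coe_smul, map_smul, smul_eq_mul]
  have k1 := key _ hv
  have k2 := key (-((t : ℂ) • X)) (by rw [norm_neg, hv])
  rw [map_neg, map_neg, hsm] at k2
  rw [hsm] at k1
  have k3 : t * |fderiv ℝ r y (fderiv ℂ Φ p X)| ≤ E₂ * τ ^ 2 := by
    rw [← abs_of_pos ht0, ← abs_mul]; exact abs_le.2 ⟨by linarith, k1⟩
  rw [hμ, smul_apply, smul_eq_mul, abs_mul, hμn] at k3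
  have k4 := mul_le_mul_of_nonneg_right (h.le_norm_fderiv y hy)
    (abs_nonneg (fderiv ℝ (bdryDist Ω) (Φ p) (fderiv ℂ Φ p X)))
  have k5 := (mul_le_mul_of_nonneg_left k4 ht0.le).trans k3
  have k6 : |fderiv ℝ (bdryDist Ω) (Φ p) (fderiv ℂ Φ p X)| ≤ E₂ * τ ^ 2 / (t * m) := by
    rw [le_div_iff₀ (by positivity)]; linarith
  refine k6.trans (le_of_eq ?_)
  rw [ht, hτ]
  field_simp

/-! ### The inward push in the source. -/

namespace IsDefiningFunction

variable {n : ℕ} {Ω : Set (Cn n)} {r : Cn n → ℝ} {R L K m : ℝ}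

/-- Moving inwards along the gradient of the defining function increases the boundary distance at
a linear rate, uniformly near the boundary. -/
theorem exists_le_bdryDist_sub_smul (h : IsDefiningFunction Ω r R L K m)
    (hF : (frontier Ω).Nonempty) :
    ∃ ε s₀ c : ℝ, 0 < ε ∧ 0 < s₀ ∧ s₀ ≤ 1 ∧ 0 < c ∧
      ∀ z ∈ Ω, bdryDist Ω z < ε → ∀ x ∈ Ω, ‖x - z‖ < ε → ∃ a : ℝ, 0 < a ∧ a ≤ 1 ∧
        ∀ s ∈ Icc 0 s₀, x - (s : ℂ) • complexGradient (fderiv ℝ r z) ∈ Ω ∧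
          c * (s + a) ≤ bdryDist Ω (x - (s : ℂ) • complexGradient (fderiv ℝ r z)) := by
  have hK := h.K_pos
  have hL := h.L_pos
  have hm := h.m_pos
  -- Freezing the gradient at `z` and the Taylor remainder each cost at most `m / 8` against `‖V‖ ≥
  -- m / 2`. The bound `1 / L` keeps the push inside the ball of radius `R + 1`.
  set ε := m / (8 * K) with hε
  set s₀ := min (min 1 (1 / L)) (m / (8 * K * L)) with hs₀
  have hs1 : s₀ ≤ 1 := (min_le_left _ _).trans (min_le_left _ _)
  have hsL : s₀ * L ≤ 1 :=
    (le_div_iff₀ hL).1 ((min_le_left _ _).trans (min_le_right _ _))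
  have hsm : K * (s₀ * L) ≤ m / 8 := by
    have : s₀ * (8 * K * L) ≤ m := (le_div_iff₀ (by positivity)).1 (min_le_right _ _)
    linarith
  have hεK : K * ε = m / 8 := by rw [hε]; field_simp
  refine ⟨ε, s₀, m ^ 2 / 8 / L, by positivity, by positivity, hs1, by positivity, ?_⟩
  intro z hz hdz x hx hxz
  have hfr : closedBall (0 : Cn n) R ⊆ closedBall 0 (R + 1) := closedBall_subset_closedBall (by simp)
  have hzB := hfr (h.closure_subset (subset_closure hz))
  have hxB := hfr (h.closure_subset (subset_closure hx))
  set V := complexGradient (fderiv ℝ r z) with hV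
  have hVn : ‖V‖ = ‖fderiv ℝ r z‖ := norm_complexGradient _
  have hVL : ‖V‖ ≤ L := hVn ▸ h.norm_fderiv_le z hzB
  have hVm : m / 2 ≤ ‖V‖ := by
    obtain ⟨y, hy, hzy⟩ := h.exists_nearest hF z
    have h1 := h.norm_fderiv_sub_le y (hfr (h.closure_subset (frontier_subset_closure hy))) z hzB
    have h2 := h.le_norm_fderiv y hy
    have h3 := norm_sub_norm_le (fderiv ℝ r y) (fderiv ℝ r z)
    rw [norm_sub_rev y z, hzy] at h1
    have h4 := mul_lt_mul_of_pos_left hdz hK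
    rw [hVn]; linarith
  have hzV : fderiv ℝ r z V = ‖V‖ ^ 2 := by
    rw [← re_inner_complexGradient, ← hV, inner_self_eq_norm_sq_to_K]; norm_cast
  have hxV : ‖V‖ * (‖V‖ - m / 8) ≤ fderiv ℝ r x V := by
    have h1 := (abs_le.1 (((fderiv ℝ r x - fderiv ℝ r z).le_opNorm V).trans
      (mul_le_mul_of_nonneg_right (h.norm_fderiv_sub_le x hxB z hzB) (norm_nonneg V)))).1
    rw [sub_apply, hzV] at h1
    have h2 : K * ‖x - z‖ * ‖V‖ ≤ m / 8 * ‖V‖ := by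
      rw [← hεK]; gcongr
    linarith
  have hrx := (h.mem_iff x).1 hx
  have hdec : ∀ s ∈ Icc 0 s₀, r (x - (s : ℂ) • V) ≤ r x - m ^ 2 / 8 * s := by
    intro s hs
    have hns : ‖(s : ℂ) • V‖ = s * ‖V‖ := by
      rw [norm_smul, Complex.norm_real, Real.norm_of_nonneg hs.1]
    have hsV : s * ‖V‖ ≤ s₀ * L := mul_le_mul hs.2 hVL (norm_nonneg _) (hs.1.trans hs.2)
    have hyB : x - (s : ℂ) • V ∈ closedBall (0 : Cn n) (R + 1) := by
      rw [mem_closedBall_zero_iff]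
      have h1 := h.subset_ball hx
      rw [mem_ball_zero_iff] at h1
      have h2 := norm_sub_le x ((s : ℂ) • V)
      rw [hns] at h2
      linarith
    have hT := (abs_le.1 (h.abs_taylor_le hxB hyB)).2
    have hlin : fderiv ℝ r x ((s : ℂ) • V) = s * fderiv ℝ r x V := by
      rw [Complex.coe_smul, map_smul, smul_eq_mul]
    rw [sub_sub_cancel_left, map_neg, norm_neg, hns, hlin] at hT
    have h1 := mul_le_mul_of_nonneg_left hxV hs.1
    have h2 : K * (s * ‖V‖) ^ 2 ≤ m / 8 * (s * ‖V‖) := by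
      have h3 : K * (s * ‖V‖) ≤ m / 8 := (mul_le_mul_of_nonneg_left hsV hK.le).trans hsm
      have h4 : 0 ≤ s * ‖V‖ := mul_nonneg hs.1 (norm_nonneg _)
      nlinarith
    have h5 : m / 2 * (m / 4) ≤ ‖V‖ * (‖V‖ - m / 8 - m / 8) :=
      mul_le_mul hVm (by linarith) (by positivity) (norm_nonneg _)
    have h6 := mul_le_mul_of_nonneg_left h5 hs.1
    have e : s * (m / 2 * (m / 4)) = m ^ 2 / 8 * s := by ring
    have e' : s * (‖V‖ * (‖V‖ - m / 8 - m / 8)) =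
        s * (‖V‖ * (‖V‖ - m / 8)) - m / 8 * (s * ‖V‖) := by ring
    linarith
  -- `a` records the initial depth of `x`; its positivity keeps powers of `s + a` differentiable at
  -- `s = 0`.
  refine ⟨min 1 (-r x / (m ^ 2 / 8)), lt_min one_pos (div_pos (by linarith) (by positivity)),
    min_le_left _ _, fun s hs => ?_⟩
  have hd := hdec s hs
  have hmem : x - (s : ℂ) • V ∈ Ω := by
    rw [h.mem_iff]
    have : 0 ≤ m ^ 2 / 8 * s := mul_nonneg (by positivity) hs.1
    linarith
  refine ⟨hmem, ?_⟩
  have h1 := h.neg_le_mul_bdryDist hF hmem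
  have h2 : min 1 (-r x / (m ^ 2 / 8)) * (m ^ 2 / 8) ≤ -r x :=
    (le_div_iff₀ (by positivity)).1 (min_le_right _ _)
  rw [div_mul_eq_mul_div, div_le_iff₀ hL]
  linarith

end IsDefiningFunction

/-! ### The derivative along the normal. -/

/-- Used to absorb bounded error terms into multiples of `d ^ (β - 1)`. -/
theorem one_le_mul_rpow {d D β : ℝ} (hd : 0 < d) (hdD : d ≤ D) (hβ : β ≤ 1) :
    1 ≤ D ^ (1 - β) * d ^ (β - 1) := by
  have hD := hd.trans_le hdD
  have := Real.one_le_rpow_of_pos_of_le_one_of_nonpos (div_pos hd hD) ((div_le_one hD).2 hdD)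
    (sub_nonpos.2 hβ)
  rw [Real.div_rpow hd.le hD.le] at this
  rw [← neg_sub β 1, Real.rpow_neg hD.le]
  rwa [div_eq_inv_mul] at this

variable {n : ℕ} {Ω₁ Ω₂ : Set (Cn n)} {r₁ r₂ : Cn n → ℝ}
  {R₁ L₁ K₁ m₁ R₂ L₂ K₂ m₂ α : ℝ} {Φ : Cn n → Cn n}

theorem norm_fderiv_le_div_bdryDist (h₁ : IsDefiningFunction Ω₁ r₁ R₁ L₁ K₁ m₁)
    (h₂ : IsDefiningFunction Ω₂ r₂ R₂ L₂ K₂ m₂) (hF₁ : (frontier Ω₁).Nonempty)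
    (hd : DifferentiableOn ℂ Φ Ω₁) (hmap : MapsTo Φ Ω₁ Ω₂) {p : Cn n} (hp : p ∈ Ω₁) :
    ‖fderiv ℂ Φ p‖ ≤ 2 * R₂ / bdryDist Ω₁ p := by
  have hs := h₁.ball_subset hF₁ hp
  refine norm_fderiv_le_of_norm_le_ball (h₁.bdryDist_pos hF₁ hp) (hd.mono hs) fun x hx => ?_
  exact (mem_ball_zero_iff.1 (h₂.subset_ball (hmap (hs hx)))).le

/-- At points of differentiability of the boundary distance, uniform preservation of the complex
normal direction bounds the derivative along the normal. -/
theorem exists_norm_fderiv_gradient_bdryDist_le [Nontrivial (Cn n)]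
    (h₁ : IsDefiningFunction Ω₁ r₁ R₁ L₁ K₁ m₁)
    (h₂ : IsDefiningFunction Ω₂ r₂ R₂ L₂ K₂ m₂) (hF₁ : (frontier Ω₁).Nonempty)
    (hF₂ : (frontier Ω₂).Nonempty)
    (hd : DifferentiableOn ℂ Φ Ω₁) (hmap : MapsTo Φ Ω₁ Ω₂)
    (hN : UniformlyPreservesComplexNormal Φ Ω₁ Ω₂)
    (hDF : BoundaryDistanceProperty Φ Ω₁ Ω₂ α) :
    ∃ ε C : ℝ, 0 < ε ∧ 0 < C ∧ ∀ p ∈ Ω₁, bdryDist Ω₁ p < ε →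
      DifferentiableAt ℝ (bdryDist Ω₁) p →
      ‖fderiv ℂ Φ p (complexGradient (fderiv ℝ (bdryDist Ω₁) p))‖ ≤
        C * bdryDist Ω₁ p ^ (α / 2 - 1) := by
  obtain ⟨U, hU, hFU, C, hC, hNC⟩ := hN
  obtain ⟨C₀, hC₀, hdist⟩ := hDF
  obtain ⟨A, hA, hLan⟩ := h₂.exists_normal_component_le hF₂
  obtain ⟨ε, hε, hεU⟩ := h₁.isCompact_frontier.exists_thickening_subset_open hU hFU
  refine ⟨ε, C * A * √C₀, hε, by positivity, fun p hp hpε hdiff => ?_⟩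
  have hpU : p ∈ U := hεU ((mem_thickening_iff_infDist_lt hF₁).2 hpε)
  have hdpos := h₁.bdryDist_pos hF₁ hp
  have hs := h₁.ball_subset hF₁ hp
  have hsqrt : √(bdryDist Ω₂ (Φ p)) ≤ √C₀ * bdryDist Ω₁ p ^ (α / 2) := by
    refine (Real.sqrt_le_sqrt (hdist p hp)).trans (le_of_eq ?_)
    rw [Real.sqrt_mul hC₀.le, Real.sqrt_eq_rpow (_ ^ α), ← Real.rpow_mul hdpos.le]
    ring_nf
  obtain ⟨y, hy, hpy⟩ := h₁.exists_nearest hF₁ p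
  obtain ⟨-, -, -, hunit⟩ := h₁.exists_fderiv_eq_smul hF₁ hp hy hpy hdiff
  set G := complexGradient (fderiv ℝ (bdryDist Ω₁) p) with hG
  -- The minus sign appears because the signed distance is `-d₁` inside.
  have hNG : complexNormal Ω₁ p = (-(Real.sqrt 2 : ℂ)) • G := by
    rw [complexNormal_eq, fderiv_signedDist h₁.isOpen hp, ← neg_one_smul ℝ, complexGradient_smul,
      smul_smul]
    simp [hG]
  have hGn : ‖G‖ = 1 := by rw [hG, norm_complexGradient, hunit]
  have hs2 : 0 < Real.sqrt 2 := by positivity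
  have hnc : ‖(-(Real.sqrt 2 : ℂ))‖ = Real.sqrt 2 := by
    rw [norm_neg, Complex.norm_real, Real.norm_of_nonneg hs2.le]
  have hNn : ‖complexNormal Ω₁ p‖ = Real.sqrt 2 := by
    rw [hNG, norm_smul, hnc, hGn, mul_one]
  have hpair : ‖delPairing (signedDist Ω₂) (Φ p) (fderiv ℂ Φ p (complexNormal Ω₁ p))‖ ≤
      A * √(bdryDist Ω₂ (Φ p)) / bdryDist Ω₁ p * Real.sqrt 2 := by
    refine norm_delPairing_le fun c hc => ?_
    rw [← map_smul, fderiv_signedDist h₂.isOpen (hmap hp), neg_apply, abs_neg]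
    refine (hLan Φ p _ _ hdpos (hd.mono hs) (hmap.mono_left hs)).trans (le_of_eq ?_)
    rw [norm_smul, hc, one_mul, hNn]
  have h1 := (hNC p ⟨hp, hpU⟩).trans (mul_le_mul_of_nonneg_left hpair hC.le)
  rw [hNG, map_smul, norm_smul, hnc] at h1
  have h2 : ‖fderiv ℂ Φ p G‖ ≤ C * A * √(bdryDist Ω₂ (Φ p)) / bdryDist Ω₁ p := by
    refine le_of_mul_le_mul_left (h1.trans (le_of_eq ?_)) hs2
    ring
  refine h2.trans ?_
  rw [Real.rpow_sub_one hdpos.ne', ← mul_div_assoc]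
  refine div_le_div_of_nonneg_right ?_ hdpos.le
  rw [mul_assoc (C * A)]
  exact mul_le_mul_of_nonneg_left hsqrt (by positivity)

/-- At a nearest boundary point `y`, `dr₁` is a multiple of the differential of the distance at `p`.
Replacing `dr₁` at `p` by its value at `y` costs `K₁ * d₁`, which Cauchy's bound `2 * R₂ / d₁` for
`Φ_*` makes bounded. Away from the boundary Cauchy alone suffices. -/
theorem exists_norm_fderiv_gradient_le [Nontrivial (Cn n)]
    (h₁ : IsDefiningFunction Ω₁ r₁ R₁ L₁ K₁ m₁)
    (h₂ : IsDefiningFunction Ω₂ r₂ R₂ L₂ K₂ m₂) (hF₁ : (frontier Ω₁).Nonempty)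
    (hF₂ : (frontier Ω₂).Nonempty)
    (hd : DifferentiableOn ℂ Φ Ω₁) (hmap : MapsTo Φ Ω₁ Ω₂)
    (hN : UniformlyPreservesComplexNormal Φ Ω₁ Ω₂) (hα : α ≤ 1)
    (hDF : BoundaryDistanceProperty Φ Ω₁ Ω₂ α) :
    ∃ C : ℝ, 0 < C ∧ ∀ p ∈ Ω₁, ‖fderiv ℂ Φ p (complexGradient (fderiv ℝ r₁ p))‖ ≤
        C * bdryDist Ω₁ p ^ (α / 2 - 1) := by
  obtain ⟨ε, C, hε, hC, hnear⟩ :=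
    exists_norm_fderiv_gradient_bdryDist_le h₁ h₂ hF₁ hF₂ hd hmap hN hDF
  have hL := h₁.L_pos
  have hK := h₁.K_pos
  have hR₁ := h₁.R_pos
  have hR₂ := h₂.R_pos
  set C' := 2 * R₂ * K₁ + 2 * R₂ * L₁ / ε with hC'
  set D := C' * (2 * R₁) ^ (1 - α / 2) with hD
  have hfr : closedBall (0 : Cn n) R₁ ⊆ closedBall 0 (R₁ + 1) :=
    closedBall_subset_closedBall (by simp)
  have hdense : ∀ p ∈ Ω₁, DifferentiableAt ℝ (bdryDist Ω₁) p →
      ‖fderiv ℂ Φ p (complexGradient (fderiv ℝ r₁ p))‖ ≤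
        (L₁ * C + D) * bdryDist Ω₁ p ^ (α / 2 - 1) := by
    intro p hp hdiff
    have hdpos := h₁.bdryDist_pos hF₁ hp
    have hpB := hfr (h₁.closure_subset (subset_closure hp))
    have hPhi := norm_fderiv_le_div_bdryDist h₁ h₂ hF₁ hd hmap hp
    have hone := one_le_mul_rpow (β := α / 2) hdpos (h₁.bdryDist_le hF₁ hp) (by linarith)
    have hD1 : C' ≤ D * bdryDist Ω₁ p ^ (α / 2 - 1) := by
      rw [hD, mul_assoc]; exact le_mul_of_one_le_right (by positivity) hone
    have hpow : 0 < bdryDist Ω₁ p ^ (α / 2 - 1) := Real.rpow_pos_of_pos hdpos _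
    rcases lt_or_ge (bdryDist Ω₁ p) ε with hlt | hge
    · obtain ⟨y, hy, hpy⟩ := h₁.exists_nearest hF₁ p
      obtain ⟨μ, hμ, hμn, -⟩ := h₁.exists_fderiv_eq_smul hF₁ hp hy hpy hdiff
      have hyB := hfr (h₁.closure_subset (frontier_subset_closure hy))
      have hsplit : complexGradient (fderiv ℝ r₁ p) =
          (μ : ℂ) • complexGradient (fderiv ℝ (bdryDist Ω₁) p) +
            complexGradient (fderiv ℝ r₁ p - fderiv ℝ r₁ y) := by
        rw [complexGradient_sub, hμ, complexGradient_smul]; abel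
      rw [hsplit, map_add, map_smul]
      refine (norm_add_le _ _).trans ?_
      have e1 : ‖(μ : ℂ) • fderiv ℂ Φ p (complexGradient (fderiv ℝ (bdryDist Ω₁) p))‖ ≤
          L₁ * (C * bdryDist Ω₁ p ^ (α / 2 - 1)) := by
        rw [norm_smul, Complex.norm_real, Real.norm_eq_abs, hμn]
        exact mul_le_mul (h₁.norm_fderiv_le y hyB) (hnear p hp hlt hdiff) (norm_nonneg _) hL.le
      have e2 : ‖fderiv ℂ Φ p (complexGradient (fderiv ℝ r₁ p - fderiv ℝ r₁ y))‖ ≤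
          2 * R₂ * K₁ := by
        refine ((fderiv ℂ Φ p).le_opNorm _).trans ?_
        rw [norm_complexGradient]
        refine (mul_le_mul hPhi (h₁.norm_fderiv_sub_le p hpB y hyB) (norm_nonneg _)
          (by positivity)).trans (le_of_eq ?_)
        rw [hpy]; field_simp
      have e3 : 0 ≤ 2 * R₂ * L₁ / ε := by positivity
      linarith
    · have e1 : ‖fderiv ℂ Φ p (complexGradient (fderiv ℝ r₁ p))‖ ≤ 2 * R₂ / ε * L₁ := by
        refine ((fderiv ℂ Φ p).le_opNorm _).trans ?_
        rw [norm_complexGradient]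
        exact mul_le_mul (hPhi.trans (by gcongr)) (h₁.norm_fderiv_le p hpB) (norm_nonneg _)
          (by positivity)
      have e2 : 0 ≤ L₁ * C * bdryDist Ω₁ p ^ (α / 2 - 1) := by positivity
      have e3 : 0 ≤ 2 * R₂ * K₁ := by positivity
      have e4 : 2 * R₂ / ε * L₁ = 2 * R₂ * L₁ / ε := by ring
      linarith
  refine ⟨L₁ * C + D, by positivity, fun p hp => ?_⟩
  have hcg : Continuous fun x => complexGradient (fderiv ℝ r₁ x) := by
    have : LipschitzWith 1 (complexGradient (n := n)) := LipschitzWith.of_dist_le_mul fun l l' => by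
      rw [dist_eq_norm, dist_eq_norm, ← complexGradient_sub, norm_complexGradient]; simp
    exact this.continuous.comp (h₁.contDiff.continuous_fderiv (by norm_num))
  have hM : ∀ x ∈ Ω₁, ‖Φ x‖ ≤ R₂ := fun x hx =>
    (mem_ball_zero_iff.1 (h₂.subset_ball (hmap hx))).le
  have hl : ContinuousAt (fun x => ‖fderiv ℂ Φ x (complexGradient (fderiv ℝ r₁ x))‖) p :=
    ((continuousAt_fderiv h₁.isOpen hd hM hp).clm_apply hcg.continuousAt).norm
  have hr : ContinuousAt (fun x => (L₁ * C + D) * bdryDist Ω₁ x ^ (α / 2 - 1)) p :=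
    continuousAt_const.mul ((continuous_infDist_pt _).continuousAt.rpow_const
      (Or.inl (h₁.bdryDist_pos hF₁ hp).ne'))
  -- Both sides are continuous in `Ω₁`, so the estimate passes from the dense set to every point.
  have hcl : p ∈ closure (Ω₁ ∩ {x | DifferentiableAt ℝ (bdryDist Ω₁) x}) :=
    (dense_differentiableAt_bdryDist Ω₁).open_subset_closure_inter h₁.isOpen hp
  have : (𝓝[Ω₁ ∩ {x | DifferentiableAt ℝ (bdryDist Ω₁) x}] p).NeBot :=
    mem_closure_iff_nhdsWithin_neBot.1 hcl
  exact le_of_tendsto_of_tendsto (hl.mono_left nhdsWithin_le_nhds) (hr.mono_left nhdsWithin_le_nhds)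
    (eventually_nhdsWithin_of_forall
      (s := Ω₁ ∩ {x | DifferentiableAt ℝ (bdryDist Ω₁) x}) fun x hx => hdense x hx.1 hx.2)

/-! ### From growth along a vector field to Hölder continuity. -/

section Hoelder

variable {E F : Type*} [NormedAddCommGroup E] [NormedSpace ℂ E]
  [NormedAddCommGroup F] [NormedSpace ℂ F]

/-- A bounded holomorphic map on an open set `Ω` with exhaustion `d`, whose derivative along the
Lipschitz vector field `V` is `O(d ^ (β - 1))`, where `d` grows linearly along `-V`. -/
structure NormalGrowth (Φ : E → F) (Ω : Set E) (d : E → ℝ) (V : E → E)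
    (β M L K C ε s₀ c : ℝ) : Prop where
  β_pos : 0 < β
  β_lt : β < 1
  M_pos : 0 < M
  L_pos : 0 < L
  K_pos : 0 < K
  C_pos : 0 < C
  ε_pos : 0 < ε
  s₀_pos : 0 < s₀
  s₀_le : s₀ ≤ 1
  c_pos : 0 < c
  differentiableOn : DifferentiableOn ℂ Φ Ω
  norm_le : ∀ x ∈ Ω, ‖Φ x‖ ≤ M
  d_pos : ∀ x ∈ Ω, 0 < d x
  ball_subset : ∀ x ∈ Ω, ball x (d x) ⊆ Ω
  d_le_add : ∀ x y, d x ≤ d y + ‖x - y‖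
  norm_V_le : ∀ x ∈ Ω, ‖V x‖ ≤ L
  norm_V_sub_le : ∀ x ∈ Ω, ∀ y ∈ Ω, ‖V x - V y‖ ≤ K * ‖x - y‖
  norm_fderiv_V_le : ∀ x ∈ Ω, ‖fderiv ℂ Φ x (V x)‖ ≤ C * d x ^ (β - 1)
  flow : ∀ z ∈ Ω, d z < ε → ∃ a : ℝ, 0 < a ∧ a ≤ 1 ∧
      ∀ s ∈ Icc 0 s₀, z - (s : ℂ) • V z ∈ Ω ∧ c * (s + a) ≤ d (z - (s : ℂ) • V z)

namespace NormalGrowth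

variable {Φ : E → F} {Ω : Set E} {d : E → ℝ} {V : E → E} {β M L K C ε s₀ c : ℝ}

theorem norm_fderiv_le (h : NormalGrowth Φ Ω d V β M L K C ε s₀ c) {x : E} (hx : x ∈ Ω) :
    ‖fderiv ℂ Φ x‖ ≤ 2 * M / d x :=
  norm_fderiv_le_of_norm_le_ball (h.d_pos x hx) (h.differentiableOn.mono (h.ball_subset x hx))
    fun y hy => h.norm_le y (h.ball_subset x hx hy)

theorem differentiableAt (h : NormalGrowth Φ Ω d V β M L K C ε s₀ c) {x : E} (hx : x ∈ Ω) :
    DifferentiableAt ℂ Φ x :=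
  h.differentiableOn.differentiableAt
    (mem_of_superset (ball_mem_nhds x (h.d_pos x hx)) (h.ball_subset x hx))

theorem norm_sub_le (h : NormalGrowth Φ Ω d V β M L K C ε s₀ c) {x y : E} {ρ : ℝ} (hx : x ∈ Ω)
    (hρ : ρ ≤ d x) (hy : ‖y - x‖ < ρ) : ‖Φ y - Φ x‖ ≤ 2 * M / ρ * ‖y - x‖ := by
  have hs := (ball_subset_ball hρ).trans (h.ball_subset x hx)
  have := Complex.dist_le_div_mul_dist_of_mapsTo_ball (R₂ := 2 * M) (h.differentiableOn.mono hs)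
    (fun z hz => ?_) (z := y) (by rwa [mem_ball, dist_eq_norm])
  · rwa [dist_eq_norm, dist_eq_norm] at this
  · rw [mem_closedBall, dist_eq_norm]
    linarith [_root_.norm_sub_le (Φ z) (Φ x), h.norm_le z (hs hz), h.norm_le x hx]

/-- The bound along the field frozen at a point `z` not too far away. -/
theorem norm_fderiv_frozen_le (h : NormalGrowth Φ Ω d V β M L K C ε s₀ c) {z x : E} (hz : z ∈ Ω)
    (hx : x ∈ Ω) {D c' σ : ℝ} (hD : 0 ≤ D) (hc' : 0 < c') (hσ : 0 < σ) (hσ2 : σ ≤ 2)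
    (hxz : ‖x - z‖ ≤ D * σ) (hdx : c' * σ ≤ d x) :
    ‖fderiv ℂ Φ x (V z)‖ ≤ (C * c' ^ (β - 1) + 4 * M * K * D / c') * σ ^ (β - 1) := by
  have hM := h.M_pos
  have hK := h.K_pos
  have hC := h.C_pos
  have hβ := h.β_pos
  have hβ1 := h.β_lt
  have hcσ : 0 < c' * σ := by positivity
  have h1 : ‖fderiv ℂ Φ x (V x)‖ ≤ C * c' ^ (β - 1) * σ ^ (β - 1) := by
    refine (h.norm_fderiv_V_le x hx).trans ?_
    rw [mul_assoc, ← Real.mul_rpow hc'.le hσ.le]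
    exact mul_le_mul_of_nonneg_left
      (Real.rpow_le_rpow_of_nonpos hcσ hdx (by linarith)) hC.le
  -- The freezing error is bounded: Cauchy loses `1 / σ`, the Lipschitz field gains `σ`.
  have h2 : ‖fderiv ℂ Φ x (V x - V z)‖ ≤ 2 * M * K * D / c' := by
    refine ((fderiv ℂ Φ x).le_opNorm _).trans ?_
    have h3 : ‖fderiv ℂ Φ x‖ ≤ 2 * M / (c' * σ) := (h.norm_fderiv_le hx).trans (by gcongr)
    have h4 : ‖V x - V z‖ ≤ K * (D * σ) := (h.norm_V_sub_le x hx z hz).trans (by gcongr)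
    refine (mul_le_mul h3 h4 (norm_nonneg _) (by positivity)).trans (le_of_eq ?_)
    field_simp
  have h5 : 1 ≤ 2 * σ ^ (β - 1) := by
    refine (one_le_mul_rpow hσ hσ2 hβ1.le).trans ?_
    have : (2 : ℝ) ^ (1 - β) ≤ 2 ^ (1 : ℝ) :=
      Real.rpow_le_rpow_of_exponent_le (by norm_num) (by linarith)
    rw [Real.rpow_one] at this
    gcongr
  have h6 : 2 * M * K * D / c' ≤ 4 * M * K * D / c' * σ ^ (β - 1) := by
    have : 0 ≤ 2 * M * K * D / c' := by positivity
    have e : 4 * M * K * D / c' * σ ^ (β - 1) = 2 * M * K * D / c' * (2 * σ ^ (β - 1)) := by ring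
    rw [e]
    exact le_mul_of_one_le_right this h5
  have h7 : fderiv ℂ Φ x (V z) = fderiv ℂ Φ x (V x) - fderiv ℂ Φ x (V x - V z) := by
    rw [map_sub]; abel
  rw [h7, add_mul]
  linarith [_root_.norm_sub_le (fderiv ℂ Φ x (V x)) (fderiv ℂ Φ x (V x - V z))]

theorem hasDerivAt_comp_sub_smul {Φ : E → F} {x e : E} {s : ℝ}
    (h : DifferentiableAt ℂ Φ (x - (s : ℂ) • e)) :
    HasDerivAt (fun τ : ℝ => Φ (x - (τ : ℂ) • e)) (-fderiv ℂ Φ (x - (s : ℂ) • e) e) s := by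
  have e1 : ∀ τ : ℂ, x - τ • e = x + τ • (-e) := fun τ => by rw [smul_neg, sub_eq_add_neg]
  have h1 : HasDerivAt (fun τ : ℂ => Φ (x + τ • (-e))) _ (s : ℂ) :=
    hasDerivAt_comp_add_smul (by rwa [← e1])
  rw [map_neg] at h1
  simp only [← e1] at h1
  simpa [Function.comp_def] using h1.scomp s Complex.ofRealCLM.hasDerivAt

/-- Hölder estimate along the field. -/
theorem norm_sub_smul_sub_le (h : NormalGrowth Φ Ω d V β M L K C ε s₀ c) {z : E} (hz : z ∈ Ω)
    (hdz : d z < ε) {s : ℝ} (hs : s ∈ Icc 0 s₀) :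
    ‖Φ (z - (s : ℂ) • V z) - Φ z‖ ≤ (C * c ^ (β - 1) + 4 * M * K * L / c) / β * s ^ β := by
  obtain ⟨a, ha, ha1, hflow⟩ := h.flow z hz hdz
  have hM := h.M_pos
  have hK := h.K_pos
  have hC := h.C_pos
  have hL := h.L_pos
  have hc := h.c_pos
  have hβ := h.β_pos
  have hs₀ := h.s₀_le
  set C₁ := C * c ^ (β - 1) + 4 * M * K * L / c with hC₁
  have hC₁0 : 0 < C₁ := by positivity
  have hder : ∀ t ∈ Icc 0 s₀, HasDerivAt (fun τ : ℝ => Φ (z - (τ : ℂ) • V z) - Φ z)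
      (-fderiv ℂ Φ (z - (t : ℂ) • V z) (V z)) t := fun t ht =>
    (hasDerivAt_comp_sub_smul (h.differentiableAt (hflow t ht).1)).sub_const _
  have hB : ∀ t ∈ Icc 0 s₀, HasDerivAt (fun τ : ℝ => C₁ / β * ((τ + a) ^ β - a ^ β))
      (C₁ * (t + a) ^ (β - 1)) t := by
    intro t ht
    have h1 : HasDerivAt (fun τ : ℝ => τ + a) 1 t := (hasDerivAt_id t).add_const a
    have h2 := ((h1.rpow_const (p := β) (Or.inl (by linarith [ht.1]))).sub_const
      (a ^ β)).const_mul (C₁ / β)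
    refine h2.congr_deriv ?_
    field_simp
  have key := image_norm_le_of_norm_deriv_right_le_deriv_boundary'
    (fun t ht => (hder t ht).continuousAt.continuousWithinAt)
    (fun t ht => (hder t (Ico_subset_Icc_self ht)).hasDerivWithinAt)
    (by simp)
    (fun t ht => (hB t ht).continuousAt.continuousWithinAt)
    (fun t ht => (hB t (Ico_subset_Icc_self ht)).hasDerivWithinAt)
    (fun t ht => ?_) hs
  · refine key.trans ?_
    -- Subadditivity of the power removes the uncontrolled depth `a`.
    have := Real.rpow_add_le_add_rpow hs.1 ha.le hβ.le h.β_lt.le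
    exact mul_le_mul_of_nonneg_left (by linarith) (by positivity)
  · have ht' := Ico_subset_Icc_self ht
    rw [norm_neg]
    refine h.norm_fderiv_frozen_le hz (hflow t ht').1 hL.le hc (by linarith [ht.1])
      (by linarith [ht'.2]) ?_ (hflow t ht').2
    rw [sub_sub_cancel_left, norm_neg, norm_smul, Complex.norm_real, Real.norm_of_nonneg ht.1,
      mul_comm L]
    exact mul_le_mul (by linarith) (h.norm_V_le z hz) (norm_nonneg _) (by linarith [ht.1])

/-- Hölder estimate between two points that have been pushed inwards by an amount comparable to
their distance. -/
theorem exists_norm_pushed_sub_le (h : NormalGrowth Φ Ω d V β M L K C ε s₀ c) :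
    ∃ C' : ℝ, 0 < C' ∧ ∀ z ∈ Ω, d z < ε → ∀ (w' : E) (η : ℝ), 0 < η → η ≤ 1 →
      16 / c * η ≤ s₀ / 2 → ‖w' - (z - ((16 / c * η : ℝ) : ℂ) • V z)‖ ≤ 2 * η →
      ‖Φ (z - ((16 / c * η : ℝ) : ℂ) • V z) - Φ w'‖ ≤ C' * η ^ β := by
  have hM := h.M_pos
  have hK := h.K_pos
  have hC := h.C_pos
  have hL := h.L_pos
  have hc := h.c_pos
  have hβ := h.β_pos
  have hβ1 : 0 < 1 - β := by linarith [h.β_lt]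
  have hs₀ := h.s₀_pos
  have hs₀1 := h.s₀_le
  set C₂ := C * (c / 2) ^ (β - 1) + 4 * M * K * (c / 2 + L) / (c / 2) with hC₂
  have hC₂0 : 0 < C₂ := by positivity
  set C₃ := 16 * C₂ / c with hC₃
  have hC₃0 : 0 < C₃ := by positivity
  refine ⟨8 * M / (c * s₀) + C₃ * (16 / c) ^ (β - 1) / (1 - β), by positivity, ?_⟩
  intro z hz hdz w' η hη hη1 hAη hw'
  -- At depth `c * A = 16 * η`, a point within `2 * η` lies in the half ball of radius `c * A / 4 =
  -- 4 * η` required by `norm_fderiv_apply_sub_le`.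
  set A := 16 / c * η with hA
  have hA0 : 0 < A := by positivity
  have hcA : c * A = 16 * η := by rw [hA]; field_simp
  set z' := z - (A : ℂ) • V z with hz'
  obtain ⟨a, ha, ha1, hflow⟩ := h.flow z hz hdz
  have hp : ∀ s ∈ Icc 0 (s₀ / 2), z' - (s : ℂ) • V z ∈ Ω ∧
      c * (A + s) ≤ d (z' - (s : ℂ) • V z) := by
    intro s hs
    have e : z' - (s : ℂ) • V z = z - ((A + s : ℝ) : ℂ) • V z := by
      rw [hz', Complex.ofReal_add, add_smul, sub_sub]
    have h1 := hflow (A + s) ⟨by linarith [hs.1], by linarith [hs.2]⟩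
    rw [e]
    exact ⟨h1.1, (mul_le_mul_of_nonneg_left (by linarith) hc.le).trans h1.2⟩
  have hqp : ∀ s : ℝ, ‖w' - (s : ℂ) • V z - (z' - (s : ℂ) • V z)‖ ≤ 2 * η := fun s => by
    rwa [sub_sub_sub_cancel_right]
  have hq : ∀ s ∈ Icc 0 (s₀ / 2), w' - (s : ℂ) • V z ∈ Ω := by
    intro s hs
    refine h.ball_subset _ (hp s hs).1 ?_
    rw [mem_ball, dist_eq_norm]
    have := mul_nonneg hc.le hs.1
    refine (hqp s).trans_lt (lt_of_lt_of_le ?_ (hp s hs).2)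
    linarith
  set G : ℝ → F := fun s => Φ (z' - (s : ℂ) • V z) - Φ (w' - (s : ℂ) • V z) with hG
  have hder : ∀ s ∈ Icc 0 (s₀ / 2), HasDerivAt (fun s => G s - G 0)
      (-fderiv ℂ Φ (z' - (s : ℂ) • V z) (V z) - -fderiv ℂ Φ (w' - (s : ℂ) • V z) (V z)) s :=
    fun s hs => ((hasDerivAt_comp_sub_smul (h.differentiableAt (hp s hs).1)).sub
      (hasDerivAt_comp_sub_smul (h.differentiableAt (hq s hs)))).sub_const _
  -- The integral of `η * (A + t) ^ (β - 2)` is at most `η * A ^ (β - 1) / (1 - β)`, of order `η ^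
  -- β`. At `t = s₀ / 2` the depth is fixed, so there the difference is `O(η)`.
  have hB : ∀ t ∈ Icc 0 (s₀ / 2), HasDerivAt
      (fun τ : ℝ => C₃ * η / (1 - β) * (A ^ (β - 1) - (A + τ) ^ (β - 1)))
      (C₃ * η * (A + t) ^ (β - 2)) t := by
    intro t ht
    have h1 : HasDerivAt (fun τ : ℝ => A + τ) 1 t := (hasDerivAt_id t).const_add A
    have h2 := ((h1.rpow_const (p := β - 1) (Or.inl (by linarith [ht.1]))).const_sub
      (A ^ (β - 1))).const_mul (C₃ * η / (1 - β))
    refine h2.congr_deriv ?_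
    rw [show β - 1 - 1 = β - 2 by ring]
    field_simp
    ring
  have hend : s₀ / 2 ∈ Icc 0 (s₀ / 2) := right_mem_Icc.2 (by positivity)
  have key := image_norm_le_of_norm_deriv_right_le_deriv_boundary'
    (fun t ht => (hder t ht).continuousAt.continuousWithinAt)
    (fun t ht => (hder t (Ico_subset_Icc_self ht)).hasDerivWithinAt)
    (by simp)
    (fun t ht => (hB t ht).continuousAt.continuousWithinAt)
    (fun t ht => (hB t (Ico_subset_Icc_self ht)).hasDerivWithinAt)
    (fun t ht => ?_) hend
  · have hηβ : η ≤ η ^ β := by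
      simpa using Real.rpow_le_rpow_of_exponent_ge hη hη1 h.β_lt.le
    have h1 : ‖G (s₀ / 2)‖ ≤ 8 * M / (c * s₀) * η ^ β := by
      have h2 : c * (s₀ / 2) ≤ c * (A + s₀ / 2) := mul_le_mul_of_nonneg_left (by linarith) hc.le
      have h3 := h.norm_sub_le (hp _ hend).1 (hp _ hend).2
        ((hqp (s₀ / 2)).trans_lt (by rw [mul_add, hcA]; linarith [mul_pos hc hs₀]))
      rw [norm_sub_rev] at h3
      refine h3.trans ?_
      calc 2 * M / (c * (A + s₀ / 2)) * _ ≤ 2 * M / (c * (s₀ / 2)) * (2 * η) := by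
            gcongr ?_ * ?_
            · gcongr
            · exact hqp _
        _ = 8 * M / (c * s₀) * η := by field_simp; ring
        _ ≤ _ := by gcongr
    have h4 : C₃ * η / (1 - β) * (A ^ (β - 1) - (A + s₀ / 2) ^ (β - 1)) ≤
        C₃ * (16 / c) ^ (β - 1) / (1 - β) * η ^ β := by
      have h5 : 0 < (A + s₀ / 2) ^ (β - 1) := Real.rpow_pos_of_pos (by positivity) _
      have h6 : A ^ (β - 1) = (16 / c) ^ (β - 1) * (η ^ β / η) := by
        rw [hA, Real.mul_rpow (by positivity) hη.le, Real.rpow_sub_one hη.ne' β]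
      calc _ ≤ C₃ * η / (1 - β) * A ^ (β - 1) := by gcongr; linarith
        _ = _ := by rw [h6]; field_simp
    have h7 : ‖G 0‖ ≤ ‖G (s₀ / 2)‖ + ‖G (s₀ / 2) - G 0‖ := by
      have := _root_.norm_sub_le (G (s₀ / 2)) (G (s₀ / 2) - G 0)
      rwa [sub_sub_cancel] at this
    have h8 : G 0 = Φ z' - Φ w' := by simp [hG]
    rw [← h8, add_mul]
    linarith
  · have ht' := Ico_subset_Icc_self ht
    have hσ : 0 < A + t := by linarith [ht.1]
    obtain ⟨hpΩ, hpd⟩ := hp t ht'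
    have hρ : 0 < c * (A + t) / 2 := by positivity
    have hsub : ball (z' - (t : ℂ) • V z) (c * (A + t) / 2) ⊆ Ω :=
      (ball_subset_ball (by linarith)).trans (h.ball_subset _ hpΩ)
    have hpz : ‖z' - (t : ℂ) • V z - z‖ ≤ L * (A + t) := by
      have e : z' - (t : ℂ) • V z - z = -(((A + t : ℝ) : ℂ) • V z) := by
        rw [hz', Complex.ofReal_add, add_smul]; abel
      rw [e, norm_neg, norm_smul, Complex.norm_real, Real.norm_of_nonneg hσ.le, mul_comm]
      exact mul_le_mul_of_nonneg_right (h.norm_V_le z hz) hσ.le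
    have hbd : ∀ x ∈ ball (z' - (t : ℂ) • V z) (c * (A + t) / 2),
        ‖fderiv ℂ Φ x (V z)‖ ≤ C₂ * (A + t) ^ (β - 1) := by
      intro x hx
      rw [mem_ball, dist_eq_norm] at hx
      refine h.norm_fderiv_frozen_le hz (hsub (by rwa [mem_ball, dist_eq_norm])) (by positivity)
        (by positivity) hσ (by linarith [ht'.2]) ?_ ?_
      · linarith [norm_sub_le_norm_sub_add_norm_sub x (z' - (t : ℂ) • V z) z]
      · have := h.d_le_add (z' - (t : ℂ) • V z) x
        rw [norm_sub_rev] at this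
        linarith
    have hLip := norm_fderiv_apply_sub_le hρ (h.differentiableOn.mono hsub) hbd
      (b := w' - (t : ℂ) • V z) (by
        rw [mem_ball, dist_eq_norm]
        have := mul_nonneg hc.le ht.1
        refine (hqp t).trans_lt ?_
        rw [mul_add, hcA]
        linarith)
    rw [dist_eq_norm] at hLip
    rw [neg_sub_neg]
    refine hLip.trans ?_
    have e : (A + t) ^ (β - 2) = (A + t) ^ (β - 1) / (A + t) := by
      rw [← Real.rpow_sub_one hσ.ne']; ring_nf
    calc _ ≤ 4 * (C₂ * (A + t) ^ (β - 1)) / (c * (A + t) / 2) * (2 * η) := by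
          gcongr; exact hqp t
      _ = _ := by rw [e, hC₃]; field_simp; ring

theorem exists_hoelder (h : NormalGrowth Φ Ω d V β M L K C ε s₀ c) :
    ∃ C' : ℝ, ∀ z ∈ Ω, ∀ w ∈ Ω, ‖Φ z - Φ w‖ ≤ C' * ‖z - w‖ ^ β := by
  obtain ⟨C₄, hC₄, hpush⟩ := h.exists_norm_pushed_sub_le
  have hM := h.M_pos
  have hK := h.K_pos
  have hC := h.C_pos
  have hL := h.L_pos
  have hc := h.c_pos
  have hβ := h.β_pos
  have hε := h.ε_pos
  have hs₀ := h.s₀_pos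
  set C₁ := (C * c ^ (β - 1) + 4 * M * K * L / c) / β with hC₁
  have hC₁0 : 0 < C₁ := by positivity
  set A := 16 / c with hA
  have hA0 : 0 < A := by positivity
  -- The four bounds give `η ≤ η ^ β`, keep `w` near the boundary when `z` is, fit the push into
  -- half the flow time, and keep the pushed points within `2 * η`.
  set η₀ := min (min 1 (ε / 2)) (min (s₀ / 2 / A) (1 / (A * K))) with hη₀
  have hη₀0 : 0 < η₀ := by positivity
  set C₅ := 2 * M / η₀ ^ β with hC₅
  set C₆ := 4 * M / ε with hC₆
  set C₇ := C₁ * A ^ β + C₄ + C₁ * A ^ β with hC₇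
  have hC₅0 : 0 < C₅ := by positivity
  have hC₆0 : 0 < C₆ := by positivity
  have hC₇0 : 0 < C₇ := by positivity
  refine ⟨C₅ + C₆ + C₇, fun z hz w hw => ?_⟩
  rcases eq_or_ne z w with rfl | hne
  · simp only [sub_self, norm_zero]; positivity
  set η := ‖z - w‖ with hη
  have hη0 : 0 < η := norm_pos_iff.2 (sub_ne_zero.2 hne)
  have hpow : 0 < η ^ β := Real.rpow_pos_of_pos hη0 _
  have hp5 := mul_pos hC₅0 hpow
  have hp6 := mul_pos hC₆0 hpow
  have hp7 := mul_pos hC₇0 hpow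
  rw [add_mul, add_mul]
  rcases le_or_gt η₀ η with hge | hlt
  · have h1 : 2 * M ≤ C₅ * η ^ β := by
      rw [hC₅, div_mul_eq_mul_div, le_div_iff₀ (by positivity)]
      gcongr
    linarith [_root_.norm_sub_le (Φ z) (Φ w), h.norm_le z hz, h.norm_le w hw]
  have hη1 : η ≤ 1 := hlt.le.trans ((min_le_left _ _).trans (min_le_left _ _))
  have hηε : η < ε / 2 := hlt.trans_le ((min_le_left _ _).trans (min_le_right _ _))
  have hηs : A * η ≤ s₀ / 2 := by
    rw [mul_comm]
    exact (le_div_iff₀ hA0).1 (hlt.le.trans ((min_le_right _ _).trans (min_le_left _ _)))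
  have hηK : A * η * (K * η) ≤ η := by
    have : η * (A * K) ≤ 1 := (le_div_iff₀ (by positivity)).1
      (hlt.le.trans ((min_le_right _ _).trans (min_le_right _ _)))
    nlinarith
  have hηβ : η ≤ η ^ β := by
    simpa using Real.rpow_le_rpow_of_exponent_ge hη0 hη1 h.β_lt.le
  rcases le_or_gt (ε / 2) (d z) with hfar | hnear
  · have h1 := h.norm_sub_le hz hfar (y := w) (by rwa [norm_sub_rev])
    rw [norm_sub_rev, norm_sub_rev w z, ← hη] at h1
    have h2 : 2 * M / (ε / 2) * η ≤ C₆ * η ^ β := by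
      have e : 2 * M / (ε / 2) = C₆ := by rw [hC₆]; field_simp; ring
      rw [e]; gcongr
    linarith
  · have hdw : d w < ε := by
      have := h.d_le_add w z
      rw [norm_sub_rev, ← hη] at this
      linarith
    have hAη : A * η ∈ Icc 0 s₀ := ⟨by positivity, by linarith⟩
    have h1 := h.norm_sub_smul_sub_le hz (by linarith) hAη
    have h2 := h.norm_sub_smul_sub_le hw hdw hAη
    rw [← hC₁, Real.mul_rpow hA0.le hη0.le, ← mul_assoc] at h1 h2
    have h3 := hpush z hz (by linarith) (w - ((A * η : ℝ) : ℂ) • V w) η hη0 hη1 hηs (by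
      have e : w - ((A * η : ℝ) : ℂ) • V w - (z - ((A * η : ℝ) : ℂ) • V z) =
          -(z - w) + ((A * η : ℝ) : ℂ) • (V z - V w) := by
        rw [smul_sub]; abel
      rw [e]
      refine (norm_add_le _ _).trans ?_
      rw [norm_neg, norm_smul, Complex.norm_real, Real.norm_of_nonneg hAη.1, ← hη]
      have := mul_le_mul_of_nonneg_left (h.norm_V_sub_le z hz w hw) hAη.1
      rw [← hη] at this
      linarith)
    set z' := z - ((A * η : ℝ) : ℂ) • V z
    set w' := w - ((A * η : ℝ) : ℂ) • V w
    have e : Φ z - Φ w = -(Φ z' - Φ z) + (Φ z' - Φ w') + (Φ w' - Φ w) := by abel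
    have h4 : ‖Φ z - Φ w‖ ≤ ‖Φ z' - Φ z‖ + ‖Φ z' - Φ w'‖ + ‖Φ w' - Φ w‖ := by
      rw [e]
      exact norm_add₃_le.trans_eq (by rw [norm_neg])
    have e7 : C₇ * η ^ β = C₁ * A ^ β * η ^ β + C₄ * η ^ β + C₁ * A ^ β * η ^ β := by
      rw [hC₇]; ring
    linarith

end NormalGrowth

end Hoelder

end NormalMapping

/-! ### Conclusion. -/

open NormalMapping in
theorem theorem3p1 {n : ℕ} (Ω₁ Ω₂ : Set (Cn n))
    (hΩ₁ : IsBoundedC2Domain Ω₁) (hΩ₂ : IsBoundedC2Domain Ω₂)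
    (Φ : Cn n → Cn n) (hΦ : IsProperHolomorphic Φ Ω₁ Ω₂)
    (hN : UniformlyPreservesComplexNormal Φ Ω₁ Ω₂)
    (α : ℝ) (hα₀ : 0 < α) (hα₁ : α ≤ 1)
    (hDF : BoundaryDistanceProperty Φ Ω₁ Ω₂ α) :
    InLip (α / 2) Φ Ω₁ := by
  obtain ⟨hd, hmap, -⟩ := hΦ
  obtain ⟨r₁, R₁, L₁, K₁, m₁, h₁⟩ := hΩ₁.exists_isDefiningFunction
  obtain ⟨r₂, R₂, L₂, K₂, m₂, h₂⟩ := hΩ₂.exists_isDefiningFunction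
  have hM : ∀ x ∈ Ω₁, ‖Φ x‖ ≤ R₂ := fun x hx =>
    (mem_ball_zero_iff.1 (h₂.subset_ball (hmap hx))).le
  refine ⟨⟨R₂, hM⟩, ?_⟩
  -- For `n = 0` the space is a point and frontiers are empty.
  rcases subsingleton_or_nontrivial (Cn n) with hn | hn
  · exact ⟨0, fun z _ w _ => by simp [Subsingleton.elim (Φ z) (Φ w)]⟩
  have hF₁ := h₁.frontier_nonempty hΩ₁.isConnected.nonempty
  have hF₂ := h₂.frontier_nonempty hΩ₂.isConnected.nonempty
  obtain ⟨C, hC, hnormal⟩ := exists_norm_fderiv_gradient_le h₁ h₂ hF₁ hF₂ hd hmap hN hα₁ hDF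
  obtain ⟨ε, s₀, c, hε, hs₀, hs₀1, hc, hflow⟩ := h₁.exists_le_bdryDist_sub_smul hF₁
  have hB : ∀ x ∈ Ω₁, x ∈ Metric.closedBall (0 : Cn n) (R₁ + 1) := fun x hx =>
    Metric.closedBall_subset_closedBall (by simp) (h₁.closure_subset (subset_closure hx))
  exact NormalGrowth.exists_hoelder (d := bdryDist Ω₁)
    (V := fun x => complexGradient (fderiv ℝ r₁ x))
    { β_pos := by linarith
      β_lt := by linarith
      M_pos := h₂.R_pos
      L_pos := h₁.L_pos
      K_pos := h₁.K_pos
      C_pos := hC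
      ε_pos := hε
      s₀_pos := hs₀
      s₀_le := hs₀1
      c_pos := hc
      differentiableOn := hd
      norm_le := hM
      d_pos := fun x hx => h₁.bdryDist_pos hF₁ hx
      ball_subset := fun x hx => h₁.ball_subset hF₁ hx
      d_le_add := bdryDist_le_add Ω₁
      norm_V_le := fun x hx => by
        rw [norm_complexGradient]; exact h₁.norm_fderiv_le x (hB x hx)
      norm_V_sub_le := fun x hx y hy => by
        rw [← complexGradient_sub, norm_complexGradient]
        exact h₁.norm_fderiv_sub_le x (hB x hx) y (hB y hy)
      norm_fderiv_V_le := hnormal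
      flow := fun z hz hdz => hflow z hz hdz z hz (by simpa using hε) }
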